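/- **Conventions.** A (small, coloured) *prop* $T$ has a set $\operatorname{Col}(T)$ of colours and, for all finite (possibly empty) lists of colours, a set of operations $T(a_1,\dots,a_n;b_1,\dots,b_m)$, with identities $\mathrm{id}_c\in T(c;c)$, vertical composition $\circ_v$ (of operations whose lists match), horizontal composition $\circ_h$ (juxtaposition of lists, including the horizontal composite of no operations, an operation from the empty list to the empty list), and actions $\sigma^*$, $\tau_*$ of permutations on inputs and outputs. These satisfy the usual axioms: both compositions are associative and satisfy interchange, the operations $\mathrm{id}_{a_1}\circ_h\dots\circ_h\mathrm{id}_{a_n}$ are units for $\circ_v$, the empty horizontal composite is a unit for $\circ_h$, the two actions are functorial, commute with each other and are compatible with $\circ_v$ and $\circ_h$, and $f\circ_h g$ and $g\circ_h f$ agree up to the block permutations. A *homomorphism* $R\to T$ consists of a function on colours and functions on operations that preserve all this structure; $\operatorname{Hom}(R,T)$ is the set of homomorphisms. Suppose a function $\chi$ assigns to each pair $(a,c)$ of elements of $\operatorname{Col}(R)\times\operatorname{Col}(S)$ a colour $\chi(a,c)$ of $T$, to each operation $\varphi:\langle a_i\rangle_{i=1}^n\to\langle b_k\rangle_{k=1}^m$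 of $R$ and each colour $c$ of $S$ an operation $\chi(\varphi,c):\langle\chi(a_i,c)\rangle_i\to\langle\chi(b_k,c)\rangle_k$, and to each colour $a$ of $R$ and each operation $\psi:\langle c_j\rangle_{j=1}^p\to\langle d_l\rangle_{l=1}^q$ of $S$ an operation $\chi(a,\psi):\langle\chi(a,c_j)\rangle_j\to\langle\chi(a,d_l)\rangle_l$. Then $\chi$ is a *bilinear map* $(R,S)\to T$ if every $\chi(a,-):S\to T$ and every $\chi(-,c):R\to T$ is a homomorphism and, for all $\varphi$ and $\psi$ as above, the octagon commutes, that is, the composites $$\langle\langle\chi(a_i,c_j)\rangle_i\rangle_j\xrightarrow{\langle\chi(\varphi,c_j)\rangle_j}\langle\langle\chi(b_k,c_j)\rangle_k\rangle_j\cong\langle\langle\chi(b_k,c_j)\rangle_j\rangle_k\xrightarrow{\langle\chi(b_k,\psi)\rangle_k}\langle\langle\chi(b_k,d_l)\rangle_l\rangle_k\cong\langle\langle\chi(b_k,d_l)\rangle_k\rangle_l,$$ $$\langle\langle\chi(a_i,c_j)\rangle_i\rangle_j\cong\langle\langle\chi(a_i,c_j)\rangle_j\rangle_i\xrightarrow{\langle\chi(a_i,\psi)\rangle_i}\langle\langle\chi(a_i,d_l)\rangle_l\rangle_i\cong\langle\langle\chi(a_i,d_l)\rangle_i\rangle_l\xrightarrow{\langle\chi(\varphi,d_l)\rangle_l}\langle\langle\chi(b_k,d_l)\rangle_k\rangle_l$$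 are equal, where $\langle f_1,\dots,f_r\rangle=f_1\circ_h\dots\circ_h f_r$ and $\cong$ is the interchange permutation. $\operatorname{Bilin}(R,S;T)$ is the set of bilinear maps. The *mapping prop* $\mathcal{H}om(R,T)$ has as colours the homomorphisms $R\to T$; an operation $\xi:\langle f_1,\dots,f_p\rangle\to\langle g_1,\dots,g_q\rangle$ is a family of operations $\xi_a:\langle f_j(a)\rangle_j\to\langle g_l(a)\rangle_l$ of $T$, for $a\in\operatorname{Col}(R)$, such that for every operation $\varphi:\langle a_i\rangle\to\langle b_k\rangle$ of $R$ the octagon formed from the $\xi_{a_i}$, $g_l(\varphi)$, $f_j(\varphi)$ and $\xi_{b_k}$ commutes. All structure is pointwise. The *tensor product* $R\otimes S$ is the prop with set of colours $\operatorname{Col}(R)\times\operatorname{Col}(S)$ that is presented by generators $\varphi\otimes c$ and $a\otimes\psi$ (for operations $\varphi$ of $R$, $\psi$ of $S$ and colours $a$ of $R$, $c$ of $S$), subject to the relations that all $-\otimes c$ and $a\otimes -$ preserve the prop structure and that all octagons formed from $\varphi$ and $\psi$ commute. Its canonical bilinear map $(R,S)\to R\otimes S$ is $(a,c)\mapsto(a,c)$,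 $(\varphi,c)\mapsto\varphi\otimes c$, $(a,\psi)\mapsto a\otimes\psi$. **Theorem.** Let $R$ and $S$ be props. The canonical bilinear map $(R,S)\to R\otimes S$ is universal among bilinear maps from $(R,S)$: for every prop $T$ and every bilinear map $\beta:(R,S)\to T$ there is exactly one homomorphism $F:R\otimes S\to T$ whose composite with the canonical bilinear map is $\beta$. Consequently $\otimes$ is a functor in both variables, uniquely so that the canonical bilinear map is natural, and composition with the canonical bilinear map gives bijections $$\operatorname{Bilin}(R,S;T)\cong\operatorname{Hom}(R\otimes S,T),$$ natural in $R$, $S$ and $T$. Moreover there are bijections $$\operatorname{Hom}(R\otimes S,T)\cong\operatorname{Hom}(R,\mathcal{H}om(S,T))\cong\operatorname{Hom}(S,\mathcal{H}om(R,T)),$$ natural in $R$, $S$ and $T$, under which the homomorphism $R\otimes S\to T$ that corresponds to a bilinear map $\chi$ corresponds to $a\mapsto\chi(a,-)$, $\varphi\mapsto\chi(\varphi,-)$ and to $c\mapsto\chi(-,c)$, $\psi\mapsto\chi(-,\psi)$. -/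

import Mathlib

universe u

namespace PropTensor

/-- The data of a (coloured) prop.  A list of colours `⟨a_1, …, a_n⟩` is a function `Fin n → Col`.
The permutation `σ` of the two actions is written as a bijection `Fin n' ≃ Fin n` (which forces
`n' = n`), and the permuted list is given together with the equation that describes its entries;
with `σ = Equiv.refl` the actions just transport along equalities of lists. -/
structure PropData where
  /-- the colours -/
  Col : Type u
  /-- the operations `T(a_1, …, a_n; b_1, …, b_m)` -/
  Hom : {n m : ℕ} → (Fin n → Col) → (Fin m → Col) → Type u
  /-- the identities -/
  id : (c : Col) → Hom (fun _ : Fin 1 => c) (fun _ : Fin 1 => c)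
  /-- the horizontal composite of no operations -/
  unit : Hom (Fin.elim0 : Fin 0 → Col) (Fin.elim0 : Fin 0 → Col)
  /-- vertical composition -/
  vcomp : {n m k : ℕ} → {a : Fin n → Col} → {b : Fin m → Col} → {c : Fin k → Col} →
    Hom b c → Hom a b → Hom a c
  /-- horizontal composition -/
  hcomp : {n m p q : ℕ} → {a : Fin n → Col} → {b : Fin m → Col} →
    {c : Fin p → Col} → {d : Fin q → Col} →
    Hom a b → Hom c d → Hom (Fin.append a c) (Fin.append b d)
  /-- the right action `σ^* : T(⟨a_i⟩; b) → T(⟨a_{σ i}⟩; b)` -/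
  permIn : {n n' m : ℕ} → {a : Fin n → Col} → {b : Fin m → Col} → (σ : Fin n' ≃ Fin n) →
    {a' : Fin n' → Col} → (∀ i, a' i = a (σ i)) → Hom a b → Hom a' b
  /-- the left action `τ_* : T(a; ⟨b_k⟩) → T(a; ⟨b_{τ⁻¹ k}⟩)` -/
  permOut : {n m m' : ℕ} → {a : Fin n → Col} → {b : Fin m → Col} → (τ : Fin m ≃ Fin m') →
    {b' : Fin m' → Col} → (∀ k, b' k = b (τ.symm k)) → Hom a b → Hom a b'

/-- The list of lists `⟨⟨x_{i j}⟩_{j}⟩_{i}`, with `i < n` and `j < p`, as one list. -/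
def grid {C : Type u} {n p : ℕ} (x : Fin n → Fin p → C) : Fin (n * p) → C :=
  fun t => x t.divNat t.modNat

/-- The interchange permutation between `⟨⟨x_{i j}⟩_j⟩_i` and `⟨⟨x_{i j}⟩_i⟩_j`. -/
def gridSwap (n p : ℕ) : Fin (n * p) ≃ Fin (p * n) :=
  finProdFinEquiv.symm.trans ((Equiv.prodComm _ _).trans finProdFinEquiv)

theorem grid_swap {C : Type u} {n p : ℕ} (x : Fin n → Fin p → C) (t : Fin (n * p)) :
    grid x t = grid (fun j i => x i j) (gridSwap n p t) := by
  obtain ⟨s, rfl⟩ := finProdFinEquiv.surjective t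
  have h1 : ∀ (a b : ℕ) (z : Fin a → Fin b → C) (s : Fin a × Fin b),
      grid z (finProdFinEquiv s) = z s.1 s.2 := by
    intro a b z s
    have h := finProdFinEquiv.symm_apply_apply s
    have e1 : (finProdFinEquiv s).divNat = s.1 := congrArg Prod.fst h
    have e2 : (finProdFinEquiv s).modNat = s.2 := congrArg Prod.snd h
    simp only [grid, e1, e2]
  simp [gridSwap, h1]

theorem grid_zero {C : Type u} {p : ℕ} (x : Fin 0 → Fin p → C) (t : Fin (0 * p)) :
    grid x t = (Fin.elim0 : Fin 0 → C) (finCongr (Nat.zero_mul p) t) :=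
  (finCongr (Nat.zero_mul p) t).elim0

theorem grid_succ {C : Type u} {n p : ℕ} (x : Fin (n + 1) → Fin p → C) (t : Fin ((n + 1) * p)) :
    grid x t = Fin.append (grid fun i => x i.castSucc) (x (Fin.last n))
      (finCongr (Nat.succ_mul n p) t) := by
  have hp : 0 < p := by
    rcases Nat.eq_zero_or_pos p with rfl | h
    · exact absurd t.2 (by simp)
    · exact h
  by_cases ht : t.val < n * p
  · have e : finCongr (Nat.succ_mul n p) t = Fin.castAdd p ⟨t.val, ht⟩ := by
      ext; simp
    rw [e, Fin.append_left]
    rfl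
  · have hlt : t.val - n * p < p := by
      have h1 : t.val < n * p + p := lt_of_lt_of_eq t.2 (Nat.succ_mul n p)
      omega
    have e : finCongr (Nat.succ_mul n p) t = Fin.natAdd (n * p) ⟨t.val - n * p, hlt⟩ := by
      ext; simp; omega
    rw [e, Fin.append_right]
    have ht' : t.val = p * n + (t.val - n * p) := by
      rw [Nat.mul_comm p n]; omega
    have e1 : t.divNat = Fin.last n := by
      ext
      simp only [Fin.coe_divNat, Fin.val_last]
      rw [ht', Nat.mul_add_div hp, Nat.div_eq_of_lt hlt, Nat.add_zero]
    have e2 : t.modNat = ⟨t.val - n * p, hlt⟩ := by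
      ext
      simp only [Fin.coe_modNat]
      conv_lhs => rw [ht', Nat.mul_add_mod, Nat.mod_eq_of_lt hlt]
    simp only [grid, e1, e2]

theorem grid_one {C : Type u} {n : ℕ} (a : Fin n → C) (i : Fin n) :
    a i = grid (fun i (_ : Fin 1) => a i) (finCongr (Nat.mul_one n).symm i) := by
  have : (finCongr (Nat.mul_one n).symm i).divNat = i := by
    ext; simp
  simp only [grid, this]

theorem append_assoc' {C : Type u} {n p r : ℕ} (a : Fin n → C) (b : Fin p → C) (c : Fin r → C)
    (i : Fin (n + p + r)) :
    Fin.append (Fin.append a b) c i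
      = Fin.append a (Fin.append b c) (finCongr (Nat.add_assoc n p r) i) :=
  congrFun (Fin.append_assoc a b c) i

theorem append_comp' {C D : Type u} {n p : ℕ} (f : C → D) (a : Fin n → C) (b : Fin p → C)
    (i : Fin (n + p)) :
    f (Fin.append a b i) = Fin.append (fun i => f (a i)) (fun i => f (b i)) i := by
  refine Fin.addCases (fun i => ?_) (fun i => ?_) i <;> simp

theorem append_comm' {C : Type u} {n p : ℕ} (a : Fin n → C) (b : Fin p → C) (i : Fin (p + n)) :
    Fin.append b a i = Fin.append a b (finAddFlip i) := by
  refine Fin.addCases (fun i => ?_) (fun i => ?_) i <;> simp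

theorem append_sum {C : Type u} {n p n' p' : ℕ} {a : Fin n → C} {b : Fin p → C}
    {a' : Fin n' → C} {b' : Fin p' → C} {σ : Fin n' ≃ Fin n} {τ : Fin p' ≃ Fin p}
    (h : ∀ i, a' i = a (σ i)) (h' : ∀ i, b' i = b (τ i)) (i : Fin (n' + p')) :
    Fin.append a' b' i = Fin.append a b
      ((finSumFinEquiv.symm.trans ((Equiv.sumCongr σ τ).trans finSumFinEquiv)) i) := by
  refine Fin.addCases (fun i => ?_) (fun i => ?_) i <;> simp [h, h']

theorem append_nil_left {C : Type u} {n : ℕ} (z : Fin 0 → C) (a : Fin n → C) (i : Fin (0 + n)) :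
    Fin.append z a i = a (finCongr (Nat.zero_add n) i) := by
  refine Fin.addCases (fun i => i.elim0) (fun i => ?_) i
  rw [Fin.append_right]
  congr 1
  ext; simp

theorem append_nil_right {C : Type u} {n : ℕ} (z : Fin 0 → C) (a : Fin n → C) (i : Fin (n + 0)) :
    Fin.append a z i = a i := by
  refine Fin.addCases (fun i => ?_) (fun i => i.elim0) i
  rw [Fin.append_left]
  rfl

/-- The block sum `σ × τ` of two permutations. -/
def blockSum {n n' p p' : ℕ} (σ : Fin n' ≃ Fin n) (τ : Fin p' ≃ Fin p) :
    Fin (n' + p') ≃ Fin (n + p) :=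
  finSumFinEquiv.symm.trans ((Equiv.sumCongr σ τ).trans finSumFinEquiv)

namespace PropData

variable (D : PropData.{u})

/-- Both actions at once: `σ^* (τ⁻¹)_*`. -/
def re {n n' m m' : ℕ} {a : Fin n → D.Col} {b : Fin m → D.Col} {a' : Fin n' → D.Col}
    {b' : Fin m' → D.Col} (σ : Fin n' ≃ Fin n) (τ : Fin m' ≃ Fin m)
    (h : ∀ i, a' i = a (σ i)) (h' : ∀ k, b' k = b (τ k)) (f : D.Hom a b) : D.Hom a' b' :=
  D.permIn σ h (D.permOut τ.symm h' f)

/-- Transport of an operation along equalities of its input and output lists. -/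
def recast {n m : ℕ} {a a' : Fin n → D.Col} {b b' : Fin m → D.Col}
    (h : ∀ i, a' i = a i) (h' : ∀ k, b' k = b k) (f : D.Hom a b) : D.Hom a' b' :=
  D.re (Equiv.refl _) (Equiv.refl _) h h' f

/-- The horizontal composite `⟨f_i⟩ = f_1 ∘_h … ∘_h f_n` of operations
`f_i : ⟨x_{i j}⟩_j → ⟨y_{i l}⟩_l`. -/
def hprod {p q : ℕ} : {n : ℕ} → {x : Fin n → Fin p → D.Col} → {y : Fin n → Fin q → D.Col} →
    (∀ i, D.Hom (x i) (y i)) → D.Hom (grid x) (grid y)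
  | 0, x, y, _ =>
    D.re (finCongr (Nat.zero_mul p)) (finCongr (Nat.zero_mul q)) (grid_zero x) (grid_zero y) D.unit
  | n + 1, x, y, f =>
    D.re (finCongr (Nat.succ_mul n p)) (finCongr (Nat.succ_mul n q)) (grid_succ x) (grid_succ y)
      (D.hcomp (hprod fun i => f i.castSucc) (f (Fin.last n)))

/-- `id_{a_1} ∘_h … ∘_h id_{a_n}`. -/
def idList {n : ℕ} (a : Fin n → D.Col) : D.Hom a a :=
  D.re (finCongr (Nat.mul_one n).symm) (finCongr (Nat.mul_one n).symm) (grid_one a) (grid_one a)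
    (D.hprod fun i => D.id (a i))

variable {D}

/-- The upper and right hand path
`⟨⟨x_{ij}⟩_j⟩_i → ⟨⟨y_{il}⟩_l⟩_i ≅ ⟨⟨y_{il}⟩_i⟩_l → ⟨⟨w_{kl}⟩_k⟩_l ≅ ⟨⟨w_{kl}⟩_l⟩_k`
of an octagon. -/
def octUpper {n m p q : ℕ} {x : Fin n → Fin p → D.Col} {y : Fin n → Fin q → D.Col}
    {w : Fin m → Fin q → D.Col}
    (top : ∀ i, D.Hom (x i) (y i))
    (right : ∀ l, D.Hom (fun i => y i l) (fun k => w k l)) : D.Hom (grid x) (grid w) :=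
  D.vcomp (D.permOut (gridSwap q m) (grid_swap w) (D.hprod right))
    (D.permOut (gridSwap n q) (grid_swap fun l i => y i l) (D.hprod top))

/-- The left hand and lower path
`⟨⟨x_{ij}⟩_j⟩_i ≅ ⟨⟨x_{ij}⟩_i⟩_j → ⟨⟨z_{kj}⟩_k⟩_j ≅ ⟨⟨z_{kj}⟩_j⟩_k → ⟨⟨w_{kl}⟩_l⟩_k`
of an octagon. -/
def octLower {n m p q : ℕ} {x : Fin n → Fin p → D.Col}
    {z : Fin m → Fin p → D.Col} {w : Fin m → Fin q → D.Col}
    (left : ∀ j, D.Hom (fun i => x i j) (fun k => z k j))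
    (bottom : ∀ k, D.Hom (z k) (w k)) : D.Hom (grid x) (grid w) :=
  D.vcomp (D.permIn (gridSwap p m) (grid_swap fun j k => z k j) (D.hprod bottom))
    (D.permIn (gridSwap n p) (grid_swap x) (D.hprod left))

end PropData

open PropData

/-- A relation between parallel operations. -/
abbrev OpRel (D : PropData.{u}) : Type u :=
  ∀ ⦃n m : ℕ⦄ ⦃a : Fin n → D.Col⦄ ⦃b : Fin m → D.Col⦄, D.Hom a b → D.Hom a b → Prop

/-- The axioms of a prop, with equality of operations replaced by a relation `r`. -/
structure PropLaws (D : PropData.{u}) (r : OpRel D) : Prop where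
  vcomp_assoc : ∀ {n m k l : ℕ} {a : Fin n → D.Col} {b : Fin m → D.Col} {c : Fin k → D.Col}
    {d : Fin l → D.Col} (f : D.Hom c d) (g : D.Hom b c) (h : D.Hom a b),
    r (D.vcomp (D.vcomp f g) h) (D.vcomp f (D.vcomp g h))
  hcomp_assoc : ∀ {n₁ m₁ n₂ m₂ n₃ m₃ : ℕ} {a₁ : Fin n₁ → D.Col} {b₁ : Fin m₁ → D.Col}
    {a₂ : Fin n₂ → D.Col} {b₂ : Fin m₂ → D.Col} {a₃ : Fin n₃ → D.Col} {b₃ : Fin m₃ → D.Col}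
    (f : D.Hom a₁ b₁) (g : D.Hom a₂ b₂) (h : D.Hom a₃ b₃),
    r (D.hcomp (D.hcomp f g) h)
      (D.re (finCongr (Nat.add_assoc n₁ n₂ n₃)) (finCongr (Nat.add_assoc m₁ m₂ m₃))
        (append_assoc' a₁ a₂ a₃) (append_assoc' b₁ b₂ b₃) (D.hcomp f (D.hcomp g h)))
  unit_hcomp : ∀ {n m : ℕ} {a : Fin n → D.Col} {b : Fin m → D.Col} (f : D.Hom a b),
    r (D.hcomp D.unit f)
      (D.re (finCongr (Nat.zero_add n)) (finCongr (Nat.zero_add m))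
        (append_nil_left _ a) (append_nil_left _ b) f)
  hcomp_unit : ∀ {n m : ℕ} {a : Fin n → D.Col} {b : Fin m → D.Col} (f : D.Hom a b),
    r (D.hcomp f D.unit) (D.recast (append_nil_right _ a) (append_nil_right _ b) f)
  vcomp_id : ∀ {n m : ℕ} {a : Fin n → D.Col} {b : Fin m → D.Col} (f : D.Hom a b),
    r (D.vcomp f (D.idList a)) f
  id_vcomp : ∀ {n m : ℕ} {a : Fin n → D.Col} {b : Fin m → D.Col} (f : D.Hom a b),
    r (D.vcomp (D.idList b) f) f
  interchange : ∀ {n m k n' m' k' : ℕ} {a : Fin n → D.Col} {b : Fin m → D.Col}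
    {c : Fin k → D.Col} {a' : Fin n' → D.Col} {b' : Fin m' → D.Col} {c' : Fin k' → D.Col}
    (f : D.Hom b c) (g : D.Hom a b) (f' : D.Hom b' c') (g' : D.Hom a' b'),
    r (D.hcomp (D.vcomp f g) (D.vcomp f' g')) (D.vcomp (D.hcomp f f') (D.hcomp g g'))
  vcomp_permOut : ∀ {n m m' k : ℕ} {a : Fin n → D.Col} {b : Fin m → D.Col} {b' : Fin m' → D.Col}
    {c : Fin k → D.Col} (σ : Fin m ≃ Fin m') (h : ∀ i, b' i = b (σ.symm i))
    (h' : ∀ i, b i = b' (σ i)) (f : D.Hom b' c) (g : D.Hom a b),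
    r (D.vcomp f (D.permOut σ h g)) (D.vcomp (D.permIn σ h' f) g)
  permIn_vcomp : ∀ {n n' m k : ℕ} {a : Fin n → D.Col} {a' : Fin n' → D.Col} {b : Fin m → D.Col}
    {c : Fin k → D.Col} (σ : Fin n' ≃ Fin n) (h : ∀ i, a' i = a (σ i))
    (f : D.Hom b c) (g : D.Hom a b),
    r (D.permIn σ h (D.vcomp f g)) (D.vcomp f (D.permIn σ h g))
  permOut_vcomp : ∀ {n m k k' : ℕ} {a : Fin n → D.Col} {b : Fin m → D.Col} {c : Fin k → D.Col}
    {c' : Fin k' → D.Col} (τ : Fin k ≃ Fin k') (h : ∀ i, c' i = c (τ.symm i))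
    (f : D.Hom b c) (g : D.Hom a b),
    r (D.permOut τ h (D.vcomp f g)) (D.vcomp (D.permOut τ h f) g)
  hcomp_permIn : ∀ {n n' m p p' q : ℕ} {a : Fin n → D.Col} {a' : Fin n' → D.Col}
    {b : Fin m → D.Col} {c : Fin p → D.Col} {c' : Fin p' → D.Col} {d : Fin q → D.Col}
    (σ : Fin n' ≃ Fin n) (σ' : Fin p' ≃ Fin p) (h : ∀ i, a' i = a (σ i))
    (h' : ∀ i, c' i = c (σ' i)) (f : D.Hom a b) (g : D.Hom c d),
    r (D.hcomp (D.permIn σ h f) (D.permIn σ' h' g))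
      (D.permIn (blockSum σ σ') (append_sum h h') (D.hcomp f g))
  hcomp_permOut : ∀ {n m m' p q q' : ℕ} {a : Fin n → D.Col} {b : Fin m → D.Col}
    {b' : Fin m' → D.Col} {c : Fin p → D.Col} {d : Fin q → D.Col} {d' : Fin q' → D.Col}
    (τ : Fin m ≃ Fin m') (τ' : Fin q ≃ Fin q') (h : ∀ i, b' i = b (τ.symm i))
    (h' : ∀ i, d' i = d (τ'.symm i)) (f : D.Hom a b) (g : D.Hom c d),
    r (D.hcomp (D.permOut τ h f) (D.permOut τ' h' g))
      (D.permOut (blockSum τ τ') (append_sum h h') (D.hcomp f g))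
  hcomp_swap : ∀ {n m p q : ℕ} {a : Fin n → D.Col} {b : Fin m → D.Col}
    {c : Fin p → D.Col} {d : Fin q → D.Col} (f : D.Hom a b) (g : D.Hom c d),
    r (D.permIn finAddFlip (append_comm' a c)
        (D.permOut finAddFlip (append_comm' b d) (D.hcomp f g)))
      (D.hcomp g f)
  permIn_permOut : ∀ {n n' m m' : ℕ} {a : Fin n → D.Col} {a' : Fin n' → D.Col} {b : Fin m → D.Col}
    {b' : Fin m' → D.Col} (σ : Fin n' ≃ Fin n) (τ : Fin m ≃ Fin m') (h : ∀ i, a' i = a (σ i))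
    (h' : ∀ k, b' k = b (τ.symm k)) (f : D.Hom a b),
    r (D.permIn σ h (D.permOut τ h' f)) (D.permOut τ h' (D.permIn σ h f))
  permIn_refl : ∀ {n m : ℕ} {a : Fin n → D.Col} {b : Fin m → D.Col} (f : D.Hom a b),
    r (D.permIn (Equiv.refl _) (fun _ => rfl) f) f
  permOut_refl : ∀ {n m : ℕ} {a : Fin n → D.Col} {b : Fin m → D.Col} (f : D.Hom a b),
    r (D.permOut (Equiv.refl _) (fun _ => rfl) f) f
  permIn_permIn : ∀ {n n' n'' m : ℕ} {a : Fin n → D.Col} {a' : Fin n' → D.Col}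
    {a'' : Fin n'' → D.Col} {b : Fin m → D.Col} (σ : Fin n'' ≃ Fin n') (σ' : Fin n' ≃ Fin n)
    (h : ∀ i, a'' i = a' (σ i)) (h' : ∀ i, a' i = a (σ' i)) (f : D.Hom a b),
    r (D.permIn σ h (D.permIn σ' h' f))
      (D.permIn (σ.trans σ') (fun i => (h i).trans (h' (σ i))) f)
  permOut_permOut : ∀ {n m m' m'' : ℕ} {a : Fin n → D.Col} {b : Fin m → D.Col}
    {b' : Fin m' → D.Col} {b'' : Fin m'' → D.Col} (τ : Fin m' ≃ Fin m'') (τ' : Fin m ≃ Fin m')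
    (h : ∀ i, b'' i = b' (τ.symm i)) (h' : ∀ i, b' i = b (τ'.symm i)) (f : D.Hom a b),
    r (D.permOut τ h (D.permOut τ' h' f))
      (D.permOut (τ'.trans τ) (fun i => (h i).trans (h' (τ.symm i))) f)

/-- Equality of operations. -/
def eqRel (D : PropData.{u}) : OpRel D := fun _ _ _ _ f g => f = g

/-- A (small, coloured) prop. -/
structure CProp extends PropData.{u} where
  laws : PropLaws toPropData (eqRel toPropData)

/-- Compatibility of a function on colours and a function on operations with the whole structure,
with equality of operations in the target replaced by a relation `r`. -/
structure MapLaws (D E : PropData.{u}) (r : OpRel E) (col : D.Col → E.Col)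
    (map : ∀ {n m : ℕ} {a : Fin n → D.Col} {b : Fin m → D.Col},
      D.Hom a b → E.Hom (fun i => col (a i)) (fun k => col (b k))) : Prop where
  map_id : ∀ c, r (map (D.id c)) (E.id (col c))
  map_unit : r (map D.unit) (E.recast (fun i => i.elim0) (fun i => i.elim0) E.unit)
  map_vcomp : ∀ {n m k : ℕ} {a : Fin n → D.Col} {b : Fin m → D.Col} {c : Fin k → D.Col}
    (f : D.Hom b c) (g : D.Hom a b), r (map (D.vcomp f g)) (E.vcomp (map f) (map g))
  map_hcomp : ∀ {n m p q : ℕ} {a : Fin n → D.Col} {b : Fin m → D.Col}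
    {c : Fin p → D.Col} {d : Fin q → D.Col} (f : D.Hom a b) (g : D.Hom c d),
    r (map (D.hcomp f g))
      (E.recast (append_comp' col a c) (append_comp' col b d) (E.hcomp (map f) (map g)))
  map_permIn : ∀ {n n' m : ℕ} {a : Fin n → D.Col} {a' : Fin n' → D.Col} {b : Fin m → D.Col}
    (σ : Fin n' ≃ Fin n) (h : ∀ i, a' i = a (σ i)) (f : D.Hom a b),
    r (map (D.permIn σ h f)) (E.permIn σ (fun i => congrArg col (h i)) (map f))
  map_permOut : ∀ {n m m' : ℕ} {a : Fin n → D.Col} {b : Fin m → D.Col} {b' : Fin m' → D.Col}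
    (τ : Fin m ≃ Fin m') (h : ∀ k, b' k = b (τ.symm k)) (f : D.Hom a b),
    r (map (D.permOut τ h f)) (E.permOut τ (fun k => congrArg col (h k)) (map f))

/-- A homomorphism of props. -/
@[ext]
structure CPropHom (R T : CProp.{u}) where
  col : R.Col → T.Col
  map : ∀ {n m : ℕ} {a : Fin n → R.Col} {b : Fin m → R.Col},
    R.Hom a b → T.Hom (fun i => col (a i)) (fun k => col (b k))
  laws : MapLaws R.toPropData T.toPropData (eqRel T.toPropData) col map

/-- A bilinear map `(R, S) → T`. -/
@[ext]
structure Bilin (R S T : CProp.{u}) where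
  /-- `χ(a, c)` -/
  col : R.Col → S.Col → T.Col
  /-- `χ(φ, c)` -/
  mapL : ∀ {n m : ℕ} {a : Fin n → R.Col} {b : Fin m → R.Col},
    R.Hom a b → (c : S.Col) → T.Hom (fun i => col (a i) c) (fun k => col (b k) c)
  /-- `χ(a, ψ)` -/
  mapR : ∀ (a : R.Col) {p q : ℕ} {c : Fin p → S.Col} {d : Fin q → S.Col},
    S.Hom c d → T.Hom (fun j => col a (c j)) (fun l => col a (d l))
  lawsR : ∀ a, MapLaws S.toPropData T.toPropData (eqRel T.toPropData) (fun c => col a c)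
    (fun ψ => mapR a ψ)
  lawsL : ∀ c, MapLaws R.toPropData T.toPropData (eqRel T.toPropData) (fun a => col a c)
    (fun φ => mapL φ c)
  octagon : ∀ {n m p q : ℕ} {a : Fin n → R.Col} {b : Fin m → R.Col}
    {c : Fin p → S.Col} {d : Fin q → S.Col} (φ : R.Hom a b) (ψ : S.Hom c d),
    octUpper (x := fun j i => col (a i) (c j)) (w := fun l k => col (b k) (d l))
        (fun j => mapL φ (c j)) (fun k => mapR (b k) ψ)
      = octLower (z := fun l i => col (a i) (d l))
        (fun i => mapR (a i) ψ) (fun l => mapL φ (d l))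

/-- A `(p, q)` natural transformation `⟨f_1, …, f_p⟩ ⇒ ⟨g_1, …, g_q⟩` of prop maps `R → T`. -/
@[ext]
structure NatTr {R T : CProp.{u}} {p q : ℕ} (f : Fin p → CPropHom R T)
    (g : Fin q → CPropHom R T) where
  app : ∀ a : R.Col, T.Hom (fun j => (f j).col a) (fun l => (g l).col a)
  natural : ∀ {n m : ℕ} {a : Fin n → R.Col} {b : Fin m → R.Col} (φ : R.Hom a b),
    octUpper (x := fun i j => (f j).col (a i)) (w := fun k l => (g l).col (b k))
        (fun i => app (a i)) (fun l => (g l).map φ)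
      = octLower (z := fun k j => (f j).col (b k))
        (fun j => (f j).map φ) (fun k => app (b k))

set_option linter.unusedSectionVars false

/-! ### Calculus of operations indexed by enumerated finite types

The following helper facts are only used to see that the constructions below are well defined. -/

/-- An enumeration of a finite type. -/
class Enm (I : Type) where
  card : ℕ
  e : I ≃ Fin card

instance (n : ℕ) : Enm (Fin n) := ⟨n, Equiv.refl _⟩
instance (I J : Type) [Enm I] [Enm J] : Enm (I ⊕ J) :=
  ⟨Enm.card I + Enm.card J, (Equiv.sumCongr Enm.e Enm.e).trans finSumFinEquiv⟩
instance (n : ℕ) (I : Type) [Enm I] : Enm (Fin n × I) :=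
  ⟨n * Enm.card I, (Equiv.prodCongr (Equiv.refl _) Enm.e).trans finProdFinEquiv⟩

namespace CProp

theorem eqr {I : Type} {C : Type u} (a : I → C) (i : I) : a (Equiv.refl I i) = a i := rfl
theorem eqr' {I : Type} {C : Type u} (a : I → C) (i : I) : a i = a (Equiv.refl I i) := rfl

variable {P : CProp.{u}}

theorem re_re {n n' n'' m m' m'' : ℕ} {a : Fin n → P.Col} {b : Fin m → P.Col} {a' : Fin n' → P.Col}
    {b' : Fin m' → P.Col} {a'' : Fin n'' → P.Col} {b'' : Fin m'' → P.Col}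
    (σ : Fin n' ≃ Fin n) (τ : Fin m' ≃ Fin m) (σ' : Fin n'' ≃ Fin n') (τ' : Fin m'' ≃ Fin m')
    (h : ∀ i, a' i = a (σ i)) (h' : ∀ k, b' k = b (τ k))
    (k : ∀ i, a'' i = a' (σ' i)) (k' : ∀ i, b'' i = b' (τ' i)) (f : P.Hom a b) :
    P.re σ' τ' k k' (P.re σ τ h h' f) =
      P.re (σ'.trans σ) (τ'.trans τ) (fun i => (k i).trans (h _)) (fun i => (k' i).trans (h' _)) f := by
  unfold PropData.re
  have e1 := P.laws.permIn_permOut σ τ'.symm h k' (P.permOut τ.symm h' f)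
  have e2 := P.laws.permIn_permIn σ' σ k h (P.permOut τ'.symm k' (P.permOut τ.symm h' f))
  have e3 := P.laws.permOut_permOut τ'.symm τ.symm k' h' f
  simp only [eqRel] at e1 e2 e3
  rw [← e1, e2, e3]
  rfl

theorem re_refl {n m : ℕ} {a : Fin n → P.Col} {b : Fin m → P.Col} (f : P.Hom a b) :
    P.re (Equiv.refl _) (Equiv.refl _) (eqr' a) (eqr' b) f = f := by
  have e1 := P.laws.permOut_refl f
  have e2 := P.laws.permIn_refl f
  simp only [eqRel] at e1 e2
  unfold PropData.re
  exact (congrArg _ e1).trans e2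

theorem re_congr {n n' m m' : ℕ} {a : Fin n → P.Col} {b : Fin m → P.Col} {a' : Fin n' → P.Col}
    {b' : Fin m' → P.Col} {σ σ' : Fin n' ≃ Fin n} {τ τ' : Fin m' ≃ Fin m}
    (h : ∀ i, a' i = a (σ i)) (h' : ∀ k, b' k = b (τ k))
    (k : ∀ i, a' i = a (σ' i)) (k' : ∀ k, b' k = b (τ' k)) (f : P.Hom a b)
    (hs : σ = σ') (ht : τ = τ') : P.re σ τ h h' f = P.re σ' τ' k k' f := by
  subst hs; subst ht; rfl

theorem permIn_eq_re {n n' m : ℕ} {a : Fin n → P.Col} {a' : Fin n' → P.Col} {b : Fin m → P.Col}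
    (σ : Fin n' ≃ Fin n) (h : ∀ i, a' i = a (σ i)) (f : P.Hom a b) :
    P.permIn σ h f = P.re σ (Equiv.refl _) h (eqr' b) f :=
  congrArg _ (P.laws.permOut_refl f).symm

theorem permOut_eq_re {n m m' : ℕ} {a : Fin n → P.Col} {b : Fin m → P.Col} {b' : Fin m' → P.Col}
    (τ : Fin m ≃ Fin m') (h : ∀ k, b' k = b (τ.symm k)) (f : P.Hom a b) :
    P.permOut τ h f = P.re (Equiv.refl _) τ.symm (eqr' a) h f :=
  (P.laws.permIn_refl _).symm

theorem vcomp_re {n n' m m' k k' : ℕ} {a : Fin n → P.Col} {b : Fin m → P.Col} {c : Fin k → P.Col}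
    {a' : Fin n' → P.Col} {b' : Fin m' → P.Col} {c' : Fin k' → P.Col}
    (ρ : Fin n' ≃ Fin n) (σ : Fin m' ≃ Fin m) (τ : Fin k' ≃ Fin k)
    (h : ∀ i, a' i = a (ρ i)) (h' h'' : ∀ i, b' i = b (σ i)) (h''' : ∀ i, c' i = c (τ i))
    (f : P.Hom b c) (g : P.Hom a b) :
    P.vcomp (P.re σ τ h' h''' f) (P.re ρ σ h h'' g) = P.re ρ τ h h''' (P.vcomp f g) := by
  have e1 := P.laws.permIn_vcomp ρ h (P.re σ τ h' h''' f) (P.permOut σ.symm h'' g)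
  have e2 := P.laws.vcomp_permOut σ.symm h'' (fun i => by simp [h']) (P.re σ τ h' h''' f) g
  have e3 := P.laws.permOut_vcomp τ.symm h''' f g
  simp only [eqRel] at e1 e2 e3
  have e4 : P.permIn σ.symm (fun i => by simp [h']) (P.re σ τ h' h''' f)
      = P.permOut τ.symm h''' f := by
    rw [permIn_eq_re, permOut_eq_re, re_re]
    exact re_congr _ _ _ _ _ (by simp) (by simp)
  conv_lhs => rw [PropData.re.eq_1 P.toPropData ρ σ]
  rw [← e1, e2, e4, ← e3]
  rfl

theorem hcomp_re {n m p q n' m' p' q' : ℕ} {a : Fin n → P.Col} {b : Fin m → P.Col}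
    {c : Fin p → P.Col} {d : Fin q → P.Col} {a' : Fin n' → P.Col} {b' : Fin m' → P.Col}
    {c' : Fin p' → P.Col} {d' : Fin q' → P.Col}
    (σ : Fin n' ≃ Fin n) (τ : Fin m' ≃ Fin m) (σ' : Fin p' ≃ Fin p) (τ' : Fin q' ≃ Fin q)
    (h₁ : ∀ i, a' i = a (σ i)) (h₂ : ∀ i, b' i = b (τ i))
    (h₃ : ∀ i, c' i = c (σ' i)) (h₄ : ∀ i, d' i = d (τ' i))
    (f : P.Hom a b) (g : P.Hom c d) :
    P.hcomp (P.re σ τ h₁ h₂ f) (P.re σ' τ' h₃ h₄ g) =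
      P.re (blockSum σ σ') (blockSum τ τ') (append_sum h₁ h₃) (append_sum h₂ h₄)
        (P.hcomp f g) := by
  have e1 := P.laws.hcomp_permIn σ σ' h₁ h₃ (P.permOut τ.symm h₂ f) (P.permOut τ'.symm h₄ g)
  have e2 := P.laws.hcomp_permOut τ.symm τ'.symm h₂ h₄ f g
  simp only [eqRel] at e1 e2
  unfold PropData.re
  rw [e1, e2]
  rfl

theorem hcomp_flip {n m p q : ℕ} {a : Fin n → P.Col} {b : Fin m → P.Col}
    {c : Fin p → P.Col} {d : Fin q → P.Col} (f : P.Hom a b) (g : P.Hom c d) :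
    P.re finAddFlip finAddFlip (append_comm' a c) (append_comm' b d) (P.hcomp f g)
      = P.hcomp g f :=
  P.laws.hcomp_swap f g

/-- Operations with inputs and outputs indexed by enumerated types. -/
abbrev HF (P : CProp.{u}) {I J : Type} [Enm I] [Enm J] (a : I → P.Col) (b : J → P.Col) : Type u :=
  P.Hom (fun t => a (Enm.e.symm t)) (fun t => b (Enm.e.symm t))

section
variable {I J K I' J' K' I'' J'' : Type} [Enm I] [Enm J] [Enm K] [Enm I'] [Enm J'] [Enm K']
  [Enm I''] [Enm J'']
  {a : I → P.Col} {b : J → P.Col} {c : K → P.Col} {a' : I' → P.Col} {b' : J' → P.Col}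
  {c' : K' → P.Col} {a'' : I'' → P.Col} {b'' : J'' → P.Col}

def push (s : I ≃ I') (t : J ≃ J') (h : ∀ i, a' (s i) = a i) (h' : ∀ j, b' (t j) = b j)
    (f : P.HF a b) : P.HF a' b' :=
  P.re (Enm.e.symm.trans (s.symm.trans Enm.e)) (Enm.e.symm.trans (t.symm.trans Enm.e))
    (fun i => by simp [← h]) (fun i => by simp [← h']) f

theorem push_push (s : I ≃ I') (t : J ≃ J') (h : ∀ i, a' (s i) = a i) (h' : ∀ j, b' (t j) = b j)
    (s' : I' ≃ I'') (t' : J' ≃ J'') (k : ∀ i, a'' (s' i) = a' i) (k' : ∀ j, b'' (t' j) = b' j)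
    (f : P.HF a b) :
    push s' t' k k' (push s t h h' f) =
      push (s.trans s') (t.trans t') (fun i => (k _).trans (h i)) (fun i => (k' _).trans (h' i)) f := by
  unfold push
  rw [re_re]
  exact re_congr _ _ _ _ _ (by ext; simp) (by ext; simp)

theorem push_congr {s s' : I ≃ I'} {t t' : J ≃ J'} (h : ∀ i, a' (s i) = a i)
    (h' : ∀ j, b' (t j) = b j) (k : ∀ i, a' (s' i) = a i) (k' : ∀ j, b' (t' j) = b j)
    (f : P.HF a b) (hs : ∀ i, s i = s' i) (ht : ∀ j, t j = t' j) :
    push s t h h' f = push s' t' k k' f := by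
  obtain rfl : s = s' := Equiv.ext hs
  obtain rfl : t = t' := Equiv.ext ht
  rfl

theorem push_refl {s : I ≃ I} {t : J ≃ J} (h : ∀ i, a (s i) = a i) (h' : ∀ j, b (t j) = b j)
    (f : P.HF a b) (hs : ∀ i, s i = i) (ht : ∀ j, t j = j) : push s t h h' f = f := by
  obtain rfl : s = Equiv.refl _ := Equiv.ext hs
  obtain rfl : t = Equiv.refl _ := Equiv.ext ht
  unfold push
  exact (re_congr _ _ _ _ _ (by ext; simp) (by ext; simp)).trans (re_refl f)

def vF (f : P.HF b c) (g : P.HF a b) : P.HF a c := P.vcomp f g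

theorem vF_push (s : I ≃ I') (t : J ≃ J') (r : K ≃ K') (h : ∀ i, a' (s i) = a i)
    (h' h'' : ∀ j, b' (t j) = b j) (k : ∀ j, c' (r j) = c j) (f : P.HF b c) (g : P.HF a b) :
    vF (push t r h' k f) (push s t h h'' g) = push s r h k (vF f g) :=
  vcomp_re _ _ _ _ _ _ _ _ _

theorem vF_assoc {d : I' → P.Col} (f : P.HF c d) (g : P.HF b c) (h : P.HF a b) :
    vF (vF f g) h = vF f (vF g h) := P.laws.vcomp_assoc f g h

def idF (a : I → P.Col) : P.HF a a := P.idList _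

theorem vF_id (f : P.HF a b) : vF f (idF a) = f := P.laws.vcomp_id f
theorem id_vF (f : P.HF a b) : vF (idF b) f = f := P.laws.id_vcomp f

theorem push_id (s : I ≃ I') (h h' : ∀ i, a' (s i) = a i) :
    push s s h h' (idF a) = idF a' := by
  have : ∀ X : P.HF a' a', vF (push s s h h' (idF a)) X = X := by
    intro X
    have hX : X = push s s h h (push s.symm s.symm (a' := a) (b' := a)
        (fun i => by rw [← h]; simp) (fun i => by rw [← h]; simp) X) := by
      rw [push_push]
      exact (push_refl _ _ _ (by simp) (by simp)).symm
    rw [hX, vF_push, id_vF]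
  rw [← vF_id (push s s h h' (idF a)), this]

theorem vF_pushOut (t : J ≃ J') (h' : ∀ j, b' (t j) = b j) (f : P.HF b' c) (g : P.HF a b) :
    vF f (push (Equiv.refl _) t (eqr a) h' g)
      = vF (push t.symm (Equiv.refl _) (fun i => by rw [← h']; simp) (eqr c) f) g := by
  conv_lhs => rw [← push_refl (s := Equiv.refl _) (t := Equiv.refl _) (eqr b') (eqr c) f
    (fun _ => rfl) (fun _ => rfl)]
  have : push (Equiv.refl _) (Equiv.refl _) (eqr b') (eqr c) f
      = push t (Equiv.refl _) h' (eqr c)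
        (push t.symm (Equiv.refl _) (fun i => by rw [← h']; simp) (eqr c) f) := by
    rw [push_push]
    exact push_congr _ _ _ _ _ (by simp) (by simp)
  rw [this, vF_push]
  exact push_refl _ _ _ (by simp) (by simp)

theorem sum_aux (x : I → P.Col) (y : K → P.Col) (t : Fin (Enm.card I + Enm.card K)) :
    Sum.elim x y ((Enm.e (I := I ⊕ K)).symm t) =
      Fin.append (fun t => x (Enm.e.symm t)) (fun t => y (Enm.e.symm t)) t := by
  refine Fin.addCases (fun i => ?_) (fun i => ?_) t
  · rw [Fin.append_left]
    have : (Enm.e (I := I ⊕ K)).symm (Fin.castAdd (Enm.card K) i) = Sum.inl (Enm.e.symm i) := by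
      rw [Equiv.symm_apply_eq]; simp [Enm.e]
    rw [this]; rfl
  · rw [Fin.append_right]
    have : (Enm.e (I := I ⊕ K)).symm (Fin.natAdd (Enm.card I) i) = Sum.inr (Enm.e.symm i) := by
      rw [Equiv.symm_apply_eq]; simp [Enm.e]
    rw [this]; rfl

def hF (f : P.HF a b) (g : P.HF c a') : P.HF (Sum.elim a c) (Sum.elim b a') :=
  P.recast (sum_aux a c) (sum_aux b a') (P.hcomp f g)

theorem e_inl (i : I) : (Enm.e (Sum.inl i : I ⊕ K)) = Fin.castAdd _ (Enm.e i) := by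
  simp [Enm.e]
theorem e_inr (i : K) : (Enm.e (Sum.inr i : I ⊕ K)) = Fin.natAdd (Enm.card I) (Enm.e i) := by
  simp [Enm.e]
theorem e_symm_inl (i : Fin (Enm.card I)) :
    (Enm.e (I := I ⊕ K)).symm (Fin.castAdd (Enm.card K) i) = Sum.inl (Enm.e.symm i) := by
  rw [Equiv.symm_apply_eq]; simp [Enm.e]
theorem e_symm_inr (i : Fin (Enm.card K)) :
    (Enm.e (I := I ⊕ K)).symm (Fin.natAdd (Enm.card I) i) = Sum.inr (Enm.e.symm i) := by
  rw [Equiv.symm_apply_eq]; simp [Enm.e]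

theorem e_ext {n : ℕ} {σ τ : Fin (Enm.card I) ≃ Fin n}
    (h : ∀ z : I, σ (Enm.e z) = τ (Enm.e z)) : σ = τ := by
  refine Equiv.ext fun t => ?_
  obtain ⟨z, rfl⟩ := (Enm.e (I := I)).surjective t
  exact h z

theorem blockSum_e (σ : Fin (Enm.card I) ≃ Fin (Enm.card I'))
    (τ : Fin (Enm.card K) ≃ Fin (Enm.card K')) (z : I ⊕ K) :
    blockSum σ τ (Enm.e z) =
      Enm.e (Sum.map (fun i => (Enm.e (I := I')).symm (σ (Enm.e i)))
        (fun i => (Enm.e (I := K')).symm (τ (Enm.e i))) z) := by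
  rcases z with i | i
  · refine (congrArg (blockSum σ τ) (e_inl i)).trans ?_
    simp [blockSum, e_inl]
  · refine (congrArg (blockSum σ τ) (e_inr i)).trans ?_
    simp [blockSum, e_inr]

theorem flip_e (z : I ⊕ K) :
    (finAddFlip (m := Enm.card I) (n := Enm.card K)) (Enm.e z) = Enm.e z.swap := by
  rcases z with i | i
  · refine (congrArg (finAddFlip (m := Enm.card I)) (e_inl i)).trans ?_
    simp [e_inr]
  · refine (congrArg (finAddFlip (m := Enm.card I)) (e_inr i)).trans ?_
    simp [e_inl]

theorem hF_push {d : J'' → P.Col} {d' : K' → P.Col}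
    (s : I ≃ I') (t : J ≃ J') (s' : K ≃ I'') (t' : J'' ≃ K')
    (h₁ : ∀ i, a' (s i) = a i) (h₂ : ∀ i, b' (t i) = b i)
    (h₃ : ∀ i, a'' (s' i) = c i) (h₄ : ∀ i, d' (t' i) = d i) (f : P.HF a b) (g : P.HF c d) :
    hF (push s t h₁ h₂ f) (push s' t' h₃ h₄ g) =
      push (Equiv.sumCongr s s') (Equiv.sumCongr t t')
        (by rintro (i | i) <;> simp [h₁, h₃]) (by rintro (i | i) <;> simp [h₂, h₄]) (hF f g) := by
  unfold hF push PropData.recast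
  rw [hcomp_re]
  refine (re_re _ _ _ _ _ _ _ _ _).trans (Eq.trans ?_ (re_re _ _ _ _ _ _ _ _ _).symm)
  refine re_congr _ _ _ _ _ (e_ext fun z => ?_) (e_ext fun z => ?_) <;>
    refine (blockSum_e _ _ z).trans ?_ <;> rcases z with i | i <;> simp

theorem hF_comm {d : J' → P.Col} (f : P.HF a b) (g : P.HF c d) :
    hF g f = push (Equiv.sumComm _ _) (Equiv.sumComm _ _)
      (by rintro (i | i) <;> rfl) (by rintro (i | i) <;> rfl) (hF f g) := by
  unfold hF push PropData.recast
  rw [← hcomp_flip]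
  refine (re_re _ _ _ _ _ _ _ _ _).trans (Eq.trans ?_ (re_re _ _ _ _ _ _ _ _ _).symm)
  refine re_congr _ _ _ _ _ (e_ext fun z => ?_) (e_ext fun z => ?_) <;>
    refine (flip_e z).trans ?_ <;> simp

theorem recast_eq {n m : ℕ} {a a' : Fin n → P.Col} {b b' : Fin m → P.Col}
    (h : ∀ i, a' i = a i) (h' : ∀ k, b' k = b k) (f : P.Hom a b) :
    P.recast h h' f = push (Equiv.refl _) (Equiv.refl _) (fun i => h i) (fun i => h' i) f := rfl

theorem hF_assoc {x : I'' → P.Col} {y : J'' → P.Col}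
    (f : P.HF a b) (g : P.HF a' b') (h : P.HF x y) :
    hF (hF f g) h = push (Equiv.sumAssoc _ _ _).symm (Equiv.sumAssoc _ _ _).symm
      (by rintro (i | i | i) <;> rfl) (by rintro (i | i | i) <;> rfl) (hF f (hF g h)) := by
  have e := P.laws.hcomp_assoc f g h
  simp only [eqRel] at e
  have e1 : P.hcomp (hF f g) h = P.re (blockSum (Equiv.refl _) (Equiv.refl _))
      (blockSum (Equiv.refl _) (Equiv.refl _)) (append_sum (sum_aux a a') (eqr' _))
      (append_sum (sum_aux b b') (eqr' _)) (P.hcomp (P.hcomp f g) h) := by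
    refine Eq.trans ?_ (hcomp_re _ _ _ _ (sum_aux a a') (sum_aux b b') (eqr' _) (eqr' _) _ _)
    rw [re_refl]; rfl
  have e2 : P.hcomp f (hF g h) = P.re (blockSum (Equiv.refl _) (Equiv.refl _))
      (blockSum (Equiv.refl _) (Equiv.refl _)) (append_sum (eqr' _) (sum_aux a' x))
      (append_sum (eqr' _) (sum_aux b' y)) (P.hcomp f (P.hcomp g h)) := by
    refine Eq.trans ?_ (hcomp_re _ _ _ _ (eqr' _) (eqr' _) (sum_aux a' x) (sum_aux b' y) _ _)
    rw [re_refl]; rfl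
  have e3 : hF (hF f g) h = P.recast (sum_aux _ x) (sum_aux _ y) (P.hcomp (hF f g) h) := rfl
  have e4 : hF f (hF g h) = P.recast (sum_aux a _) (sum_aux b _) (P.hcomp f (hF g h)) := rfl
  rw [e3, e4, e1, e2, e]
  refine (congrArg _ (re_re _ _ _ _ _ _ _ _ _)).trans ?_
  refine (re_re _ _ _ _ _ _ _ _ _).trans (Eq.trans ?_ (re_re _ _ _ _ _ _ _ _ _).symm)
  refine Eq.trans ?_ (re_re _ _ _ _ _ _ _ _ _).symm
  have key : ∀ (i₁ i₂ i₃ : Type) [Enm i₁] [Enm i₂] [Enm i₃]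
      (t : Fin (Enm.card i₁ + Enm.card i₂ + Enm.card i₃)),
      blockSum (Equiv.refl (Fin (Enm.card i₁ + Enm.card i₂))) (Equiv.refl (Fin (Enm.card i₃))) t
        = t := by
    intro i₁ i₂ i₃ _ _ _ t
    refine Fin.addCases (fun i => ?_) (fun i => ?_) t <;> simp [blockSum]
  have key' : ∀ (i₁ i₂ i₃ : Type) [Enm i₁] [Enm i₂] [Enm i₃]
      (t : Fin (Enm.card i₁ + (Enm.card i₂ + Enm.card i₃))),
      blockSum (Equiv.refl (Fin (Enm.card i₁))) (Equiv.refl (Fin (Enm.card i₂ + Enm.card i₃))) t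
        = t := by
    intro i₁ i₂ i₃ _ _ _ t
    refine Fin.addCases (fun i => ?_) (fun i => ?_) t <;> simp [blockSum]
  have main : ∀ (i₁ i₂ i₃ : Type) [Enm i₁] [Enm i₂] [Enm i₃]
      (t : Fin (Enm.card i₁ + Enm.card i₂ + Enm.card i₃)),
      finCongr (Nat.add_assoc (Enm.card i₁) (Enm.card i₂) (Enm.card i₃)) t =
        Enm.e (Equiv.sumAssoc i₁ i₂ i₃ (Enm.e.symm t)) := by
    intro i₁ i₂ i₃ _ _ _ t
    refine Fin.addCases (fun i => ?_) (fun i => ?_) t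
    · refine Fin.addCases (fun i => ?_) (fun i => ?_) i
      · have h1 := e_symm_inl (I := i₁ ⊕ i₂) (K := i₃) (Fin.castAdd (Enm.card i₂) i)
        have h2 := e_symm_inl (I := i₁) (K := i₂) i
        rw [h2] at h1
        refine Eq.trans ?_ (congrArg (fun z => Enm.e (Equiv.sumAssoc i₁ i₂ i₃ z)) h1.symm)
        simp only [Equiv.sumAssoc_apply_inl_inl, e_inl, Equiv.apply_symm_apply]
        ext; simp
      · have h1 := e_symm_inl (I := i₁ ⊕ i₂) (K := i₃) (Fin.natAdd (Enm.card i₁) i)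
        have h2 := e_symm_inr (I := i₁) (K := i₂) i
        rw [h2] at h1
        refine Eq.trans ?_ (congrArg (fun z => Enm.e (Equiv.sumAssoc i₁ i₂ i₃ z)) h1.symm)
        simp only [Equiv.sumAssoc_apply_inl_inr, e_inl, e_inr, Equiv.apply_symm_apply]
        ext; simp
    · have h1 := e_symm_inr (I := i₁ ⊕ i₂) (K := i₃) i
      refine Eq.trans ?_ (congrArg (fun z => Enm.e (Equiv.sumAssoc i₁ i₂ i₃ z)) h1.symm)
      simp only [Equiv.sumAssoc_apply_inr, e_inr, Equiv.apply_symm_apply]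
      ext; simp [Enm.card, Nat.add_assoc]
  refine re_congr _ _ _ _ _ (Equiv.ext fun t => ?_) (Equiv.ext fun t => ?_)
  · simp only [Equiv.trans_apply, Equiv.symm_symm, Equiv.refl_trans]
    refine Eq.trans ?_ (key' _ _ _ _).symm
    exact (congrArg _ (key _ _ _ t)).trans (main _ _ _ t)
  · simp only [Equiv.trans_apply, Equiv.symm_symm, Equiv.refl_trans]
    refine Eq.trans ?_ (key' _ _ _ _).symm
    exact (congrArg _ (key _ _ _ t)).trans (main _ _ _ t)

theorem hF_interchange {x : I'' → P.Col} {y : J'' → P.Col} {z : K' → P.Col}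
    (f : P.HF b c) (g : P.HF a b) (f' : P.HF y z) (g' : P.HF x y) :
    hF (vF f g) (vF f' g') = vF (hF f f') (hF g g') := by
  have e := P.laws.interchange f g f' g'
  simp only [eqRel] at e
  unfold hF PropData.recast
  unfold vF
  rw [e]
  exact (vcomp_re _ _ _ _ _ _ _ _ _).symm

/-- The unit, on arbitrary empty lists. -/
def uF (x y : Fin 0 → P.Col) : P.HF x y :=
  P.recast (fun i => i.elim0) (fun i => i.elim0) P.unit

theorem push_uF {x y x' y' : Fin 0 → P.Col} (s t : Fin 0 ≃ Fin 0) (h : ∀ i, x' (s i) = x i)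
    (h' : ∀ i, y' (t i) = y i) : push s t h h' (P.uF x y) = P.uF x' y' := by
  obtain rfl : x = x' := Subsingleton.elim _ _
  obtain rfl : y = y' := Subsingleton.elim _ _
  exact push_refl _ _ _ (fun i => i.elim0) (fun i => i.elim0)

theorem uF_elim0 : P.uF Fin.elim0 Fin.elim0 = P.unit := re_refl _

theorem uF_hF {x y : Fin 0 → P.Col} (f : P.HF a b) :
    hF (P.uF x y) f = push (Equiv.emptySum (Fin 0) I).symm (Equiv.emptySum (Fin 0) J).symm
      (fun _ => rfl) (fun _ => rfl) f := by
  obtain rfl : x = Fin.elim0 := Subsingleton.elim _ _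
  obtain rfl : y = Fin.elim0 := Subsingleton.elim _ _
  have e := P.laws.unit_hcomp f
  simp only [eqRel] at e
  rw [uF_elim0]
  refine (congrArg (P.recast (sum_aux _ a) (sum_aux _ b)) e).trans ?_
  refine (re_re _ _ _ _ _ _ _ _ _).trans ?_
  refine re_congr _ _ _ _ _ (e_ext (I := Fin 0 ⊕ I) fun z => ?_)
    (e_ext (I := Fin 0 ⊕ J) fun z => ?_)
  · rcases z with i | i
    · exact i.elim0
    · have h1 := e_inr (I := Fin 0) (K := I) i
      refine (congrArg (finCongr (Nat.zero_add _)) h1).trans ?_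
      simp [Enm.card]
  · rcases z with i | i
    · exact i.elim0
    · have h1 := e_inr (I := Fin 0) (K := J) i
      refine (congrArg (finCongr (Nat.zero_add _)) h1).trans ?_
      simp [Enm.card]

theorem hF_uF {x y : Fin 0 → P.Col} (f : P.HF a b) :
    hF f (P.uF x y) = push (Equiv.sumEmpty I (Fin 0)).symm (Equiv.sumEmpty J (Fin 0)).symm
      (fun _ => rfl) (fun _ => rfl) f := by
  rw [hF_comm, uF_hF]
  refine (push_push _ _ _ _ _ _ _ _ _).trans ?_
  exact push_congr _ _ _ _ _ (fun i => rfl) (fun i => rfl)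

/-! Horizontal composites of families. -/

/-- A list of lists as one function. -/
abbrev G {n : ℕ} (x : Fin n → I → P.Col) : Fin n × I → P.Col := fun s => x s.1 s.2

def prodF {n : ℕ} {x : Fin n → I → P.Col} {y : Fin n → J → P.Col}
    (f : ∀ i, P.HF (x i) (y i)) : P.HF (G x) (G y) :=
  P.hprod (x := fun i t => x i (Enm.e.symm t)) (y := fun i t => y i (Enm.e.symm t)) f

/-- `Option A × I ≃ (A × I) ⊕ I`, restricted to finite ordinals: the summand `k` is split off. -/
def splitE {n : ℕ} (k : Fin (n + 1)) (I : Type) : (Fin n × I) ⊕ I ≃ Fin (n + 1) × I where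
  toFun := Sum.elim (fun s => (k.succAbove s.1, s.2)) (fun i => (k, i))
  invFun s := match finSuccEquiv' k s.1 with
    | none => Sum.inr s.2
    | some j => Sum.inl (j, s.2)
  left_inv := by
    rintro (⟨j, i⟩ | i) <;> simp
  right_inv := by
    rintro ⟨j, i⟩
    rcases Fin.eq_self_or_eq_succAbove k j with rfl | ⟨j, rfl⟩ <;> simp

@[simp] theorem splitE_inl {n : ℕ} (k : Fin (n + 1)) (s : Fin n × I) :
    splitE k I (Sum.inl s) = (k.succAbove s.1, s.2) := rfl
@[simp] theorem splitE_inr {n : ℕ} (k : Fin (n + 1)) (i : I) :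
    splitE k I (Sum.inr i) = (k, i) := rfl

def emptyE (I : Type) : Fin 0 ≃ Fin 0 × I := ⟨fun i => i.elim0, fun i => i.1.elim0,
  fun i => i.elim0, fun i => i.1.elim0⟩

theorem prodF_zero {x : Fin 0 → I → P.Col} {y : Fin 0 → J → P.Col}
    (f : ∀ i, P.HF (x i) (y i)) :
    prodF f = push (emptyE I) (emptyE J) (fun i => i.elim0) (fun i => i.elim0)
      (P.uF Fin.elim0 Fin.elim0) := by
  rw [uF_elim0]
  exact re_congr _ _ _ _ _ (e_ext (I := Fin 0 × I) fun z => z.1.elim0)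
    (e_ext (I := Fin 0 × J) fun z => z.1.elim0)

theorem split_e {n : ℕ} (z : Fin (n + 1) × I) :
    finCongr (Nat.succ_mul n (Enm.card I)) (Enm.e z) =
      Enm.e ((splitE (Fin.last n) I).symm z) := by
  obtain ⟨z, rfl⟩ := (splitE (Fin.last n) I).surjective z
  rw [Equiv.symm_apply_apply]
  rcases z with ⟨j, i⟩ | i
  · rw [e_inl]
    ext
    simp [Enm.e, Enm.card]
  · rw [e_inr]
    ext
    simp [Enm.e, Enm.card, Nat.mul_comm, Nat.add_comm]

theorem prodF_succ {n : ℕ} {x : Fin (n + 1) → I → P.Col} {y : Fin (n + 1) → J → P.Col}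
    (f : ∀ i, P.HF (x i) (y i)) :
    prodF f = push (splitE (Fin.last n) I) (splitE (Fin.last n) J)
      (a' := G x) (b' := G y) (a := Sum.elim (G fun i => x i.castSucc) (x (Fin.last n)))
      (b := Sum.elim (G fun i => y i.castSucc) (y (Fin.last n)))
      (by rintro (i | i) <;> simp [G]) (by rintro (i | i) <;> simp [G])
      (hF (prodF fun i => f i.castSucc) (f (Fin.last n))) := by
  refine Eq.trans ?_ (re_re _ _ _ _ _ _ _ _ _).symm
  refine re_congr _ _ _ _ _ (e_ext (I := Fin (n + 1) × I) fun z => ?_)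
    (e_ext (I := Fin (n + 1) × J) fun z => ?_) <;>
  · refine (split_e z).trans ?_
    simp
/-- `g` is obtained from `f` by moving the inputs along `s` and the outputs along `t`. -/
def IP (s : I ≃ I') (t : J ≃ J') (f : P.HF a b) (g : P.HF a' b') : Prop :=
  ∃ h h', push s t h h' f = g

theorem IP.refl (f : P.HF a b) : IP (Equiv.refl _) (Equiv.refl _) f f :=
  ⟨eqr a, eqr b, push_refl _ _ _ (fun _ => rfl) (fun _ => rfl)⟩

theorem IP.trans {s : I ≃ I'} {t : J ≃ J'} {s' : I' ≃ I''} {t' : J' ≃ J''} {f : P.HF a b}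
    {g : P.HF a' b'} {k : P.HF a'' b''} (h : IP s t f g) (h' : IP s' t' g k) :
    IP (s.trans s') (t.trans t') f k := by
  obtain ⟨h1, h2, rfl⟩ := h
  obtain ⟨h3, h4, rfl⟩ := h'
  exact ⟨_, _, (push_push s t h1 h2 s' t' h3 h4 f).symm⟩

theorem IP.congr {s s' : I ≃ I'} {t t' : J ≃ J'} {f : P.HF a b} {g : P.HF a' b'}
    (h : IP s t f g) (hs : ∀ i, s i = s' i) (ht : ∀ i, t i = t' i) : IP s' t' f g := by
  obtain rfl := Equiv.ext hs
  obtain rfl := Equiv.ext ht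
  exact h

theorem IP.symm {s : I ≃ I'} {t : J ≃ J'} {f : P.HF a b} {g : P.HF a' b'} (h : IP s t f g) :
    IP s.symm t.symm g f := by
  obtain ⟨h1, h2, rfl⟩ := h
  refine ⟨fun i => by rw [← h1]; simp, fun i => by rw [← h2]; simp, ?_⟩
  exact (push_push _ _ _ _ _ _ _ _ _).trans (push_refl _ _ _ (by simp) (by simp))

theorem IP.eq {s : I ≃ I} {t : J ≃ J} {f g : P.HF a b} (h : IP s t f g)
    (hs : ∀ i, s i = i) (ht : ∀ i, t i = i) : f = g := by
  obtain ⟨h1, h2, rfl⟩ := h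
  exact (push_refl _ _ _ hs ht).symm

theorem IP.unique {s s' : I ≃ I'} {t t' : J ≃ J'} {f : P.HF a b} {g g' : P.HF a' b'}
    (h : IP s t f g) (h' : IP s' t' f g') (hs : ∀ i, s i = s' i) (ht : ∀ i, t i = t' i) :
    g = g' :=
  (h.symm.trans (h'.congr (fun i => (hs i).symm) (fun i => (ht i).symm))).eq (by simp) (by simp)

theorem IP.h {x : I'' → P.Col} {y : J'' → P.Col} {s : I ≃ I'} {t : J ≃ J'} {s' : K ≃ I''}
    {t' : K' ≃ J''} {f : P.HF a b} {f' : P.HF a' b'} {g : P.HF c c'} {g' : P.HF x y}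
    (h : IP s t f f') (h' : IP s' t' g g') :
    IP (Equiv.sumCongr s s') (Equiv.sumCongr t t') (hF f g) (hF f' g') := by
  obtain ⟨h1, h2, rfl⟩ := h
  obtain ⟨h3, h4, rfl⟩ := h'
  exact ⟨_, _, (hF_push _ _ _ _ h1 h2 h3 h4 f g).symm⟩

theorem IP.v {s : I ≃ I'} {t : J ≃ J'} {r : K ≃ K'} {f : P.HF b c} {g : P.HF a b}
    {f' : P.HF b' c'} {g' : P.HF a' b'} (h : IP t r f f') (h' : IP s t g g') :
    IP s r (vF f g) (vF f' g') := by
  obtain ⟨h1, h2, rfl⟩ := h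
  obtain ⟨h3, h4, rfl⟩ := h'
  exact ⟨_, _, (vF_push s t r h3 h1 h4 h2 f g).symm⟩

theorem IP.comm {d : J' → P.Col} (f : P.HF a b) (g : P.HF c d) :
    IP (Equiv.sumComm _ _) (Equiv.sumComm _ _) (hF f g) (hF g f) := ⟨_, _, (hF_comm f g).symm⟩

theorem IP.assoc {x : I'' → P.Col} {y : J'' → P.Col}
    (f : P.HF a b) (g : P.HF a' b') (h : P.HF x y) :
    IP (Equiv.sumAssoc _ _ _) (Equiv.sumAssoc _ _ _)
      (hF (hF f g) h) (hF f (hF g h)) :=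
  IP.symm (s := (Equiv.sumAssoc _ _ _).symm) (t := (Equiv.sumAssoc _ _ _).symm)
    ⟨_, _, (hF_assoc f g h).symm⟩

theorem IP.u (x y x' y' : Fin 0 → P.Col) (s t : Fin 0 ≃ Fin 0) :
    IP s t (P.uF x y) (P.uF x' y') :=
  ⟨fun i => i.elim0, fun i => i.elim0, push_uF _ _ _ _⟩

theorem IP.uhF (x y : Fin 0 → P.Col) (f : P.HF a b) :
    IP (Equiv.emptySum (Fin 0) I) (Equiv.emptySum (Fin 0) J) (hF (P.uF x y) f) f :=
  IP.symm (s := (Equiv.emptySum (Fin 0) I).symm) (t := (Equiv.emptySum (Fin 0) J).symm)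
    ⟨_, _, (uF_hF f).symm⟩

theorem IP.hFu (x y : Fin 0 → P.Col) (f : P.HF a b) :
    IP (Equiv.sumEmpty I (Fin 0)) (Equiv.sumEmpty J (Fin 0)) (hF f (P.uF x y)) f :=
  IP.symm (s := (Equiv.sumEmpty I (Fin 0)).symm) (t := (Equiv.sumEmpty J (Fin 0)).symm)
    ⟨_, _, (hF_uF f).symm⟩

theorem IP.zero {x : Fin 0 → I → P.Col} {y : Fin 0 → J → P.Col} (u v : Fin 0 → P.Col)
    (f : ∀ i, P.HF (x i) (y i)) : IP (emptyE I) (emptyE J) (P.uF u v) (prodF f) := by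
  obtain rfl : u = Fin.elim0 := Subsingleton.elim _ _
  obtain rfl : v = Fin.elim0 := Subsingleton.elim _ _
  exact ⟨_, _, (prodF_zero f).symm⟩

theorem IP.succ {n : ℕ} {x : Fin (n + 1) → I → P.Col} {y : Fin (n + 1) → J → P.Col}
    (f : ∀ i, P.HF (x i) (y i)) :
    IP (splitE (Fin.last n) I) (splitE (Fin.last n) J)
      (hF (prodF fun i => f i.castSucc) (f (Fin.last n))) (prodF f) :=
  ⟨_, _, (prodF_succ f).symm⟩

theorem IP.prod {n : ℕ} {x : Fin n → I → P.Col} {y : Fin n → J → P.Col}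
    {x' : Fin n → I' → P.Col} {y' : Fin n → J' → P.Col} {s : I ≃ I'} {t : J ≃ J'}
    {f : ∀ i, P.HF (x i) (y i)} {f' : ∀ i, P.HF (x' i) (y' i)} (h : ∀ i, IP s t (f i) (f' i)) :
    IP (Equiv.prodCongr (Equiv.refl _) s) (Equiv.prodCongr (Equiv.refl _) t)
      (prodF f) (prodF f') := by
  induction n with
  | zero =>
    exact ((IP.zero Fin.elim0 Fin.elim0 f).symm.trans (IP.zero Fin.elim0 Fin.elim0 f')).congr
      (fun i => i.1.elim0) (fun i => i.1.elim0)
  | succ n ih =>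
    refine ((IP.succ f).symm.trans (((ih fun i => h i.castSucc).h (h (Fin.last n))).trans
      (IP.succ f'))).congr (fun i => ?_) (fun i => ?_)
    · obtain ⟨i, rfl⟩ := (splitE (Fin.last n) I).surjective i
      simp only [Equiv.trans_apply, Equiv.symm_apply_apply]
      rcases i with i | i <;> simp
    · obtain ⟨i, rfl⟩ := (splitE (Fin.last n) J).surjective i
      simp only [Equiv.trans_apply, Equiv.symm_apply_apply]
      rcases i with i | i <;> simp

/-- The unique identity of the empty list is the nullary horizontal composite. -/
theorem IP.uF_id {u : Fin 0 → P.Col} : P.uF u u = idF u := by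
  have h := IP.zero (I := Fin 1) (J := Fin 1) u u (x := fun i _ => u i) (y := fun i _ => u i)
    (fun i : Fin 0 => P.id (u i))
  obtain ⟨h1, h2, h3⟩ := h
  refine Eq.trans ?_ (congrArg (P.re _ _ (grid_one _) (grid_one _)) h3)
  refine Eq.trans ?_ (re_re _ _ _ _ _ _ _ _ _).symm
  exact (re_refl _).symm.trans (re_congr _ _ _ _ _ (Equiv.ext fun i => i.elim0)
    (Equiv.ext fun i => i.elim0))

theorem prodF_vF {n : ℕ} {x : Fin n → I → P.Col} {y : Fin n → J → P.Col} {z : Fin n → K → P.Col}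
    (f : ∀ i, P.HF (y i) (z i)) (g : ∀ i, P.HF (x i) (y i)) :
    prodF (fun i => vF (f i) (g i)) = vF (prodF f) (prodF g) := by
  induction n with
  | zero =>
    refine IP.unique (IP.zero Fin.elim0 Fin.elim0 _)
      (Eq.mp (congrArg (fun z => IP (emptyE I) (emptyE K) z (vF (prodF f) (prodF g))) ?_)
        (IP.v (IP.zero Fin.elim0 Fin.elim0 f) (IP.zero Fin.elim0 Fin.elim0 g)))
      (fun _ => rfl) (fun _ => rfl)
    rw [IP.uF_id, vF_id]
  | succ n ih =>
    refine IP.unique (IP.succ _) (Eq.mp (congrArg (fun z => IP (splitE (Fin.last n) I)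
        (splitE (Fin.last n) K) z (vF (prodF f) (prodF g))) ?_)
        (IP.v (IP.succ f) (IP.succ g))) (fun _ => rfl) (fun _ => rfl)
    rw [ih, hF_interchange]

/-- The distributivity bijection. -/
def distE (n : ℕ) (I K : Type) : (Fin n × I) ⊕ (Fin n × K) ≃ Fin n × (I ⊕ K) :=
  (Equiv.prodSumDistrib _ _ _).symm

@[simp] theorem distE_inl (n : ℕ) (s : Fin n × I) :
    distE n I K (Sum.inl s) = (s.1, Sum.inl s.2) := rfl
@[simp] theorem distE_inr (n : ℕ) (s : Fin n × K) :
    distE n I K (Sum.inr s) = (s.1, Sum.inr s.2) := rfl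

theorem IP.middle {x₁ : I → P.Col} {y₁ : J → P.Col} {x₂ : K → P.Col} {y₂ : I' → P.Col}
    {x₃ : J' → P.Col} {y₃ : K' → P.Col} {x₄ : I'' → P.Col} {y₄ : J'' → P.Col}
    (f₁ : P.HF x₁ y₁) (f₂ : P.HF x₂ y₂) (f₃ : P.HF x₃ y₃) (f₄ : P.HF x₄ y₄) :
    IP (Equiv.sumSumSumComm _ _ _ _) (Equiv.sumSumSumComm _ _ _ _)
      (hF (hF f₁ f₂) (hF f₃ f₄)) (hF (hF f₁ f₃) (hF f₂ f₄)) :=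
  ((IP.assoc (hF f₁ f₂) f₃ f₄).symm.trans
    (((((IP.assoc f₁ f₂ f₃).trans ((IP.refl f₁).h (IP.comm f₂ f₃))).trans
      (IP.assoc f₁ f₃ f₂).symm).h (IP.refl f₄)).trans (IP.assoc (hF f₁ f₃) f₂ f₄))).congr
    (by rintro ((i | i) | (i | i)) <;> rfl) (by rintro ((i | i) | (i | i)) <;> rfl)

theorem IP.prod_hF {n : ℕ} {x : Fin n → I → P.Col} {y : Fin n → J → P.Col}
    {x' : Fin n → I' → P.Col} {y' : Fin n → J' → P.Col}
    (f : ∀ i, P.HF (x i) (y i)) (g : ∀ i, P.HF (x' i) (y' i)) :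
    IP (distE n I I') (distE n J J') (hF (prodF f) (prodF g))
      (prodF (fun i => hF (f i) (g i))) := by
  induction n with
  | zero =>
    exact ((((IP.zero Fin.elim0 Fin.elim0 f).h (IP.zero Fin.elim0 Fin.elim0 g)).symm.trans
      (IP.uhF _ _ _)).trans (IP.zero _ _ _)).congr
      (by rintro (i | i) <;> exact i.1.elim0) (by rintro (i | i) <;> exact i.1.elim0)
  | succ n ih =>
    refine ((((IP.succ f).h (IP.succ g)).symm.trans (IP.middle _ _ _ _)).trans
      (((ih _ _).h (IP.refl _)).trans (IP.succ fun i => hF (f i) (g i)))).congr (fun i => ?_) (fun i => ?_)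
    · obtain ⟨i, rfl⟩ := (Equiv.sumCongr (splitE (Fin.last n) I)
        (splitE (Fin.last n) I')).surjective i
      have e := Equiv.symm_apply_apply (Equiv.sumCongr (splitE (Fin.last n) I)
        (splitE (Fin.last n) I')) i
      simp only [Equiv.trans_apply, e]
      rcases i with (i | i) | (i | i) <;> simp
    · obtain ⟨i, rfl⟩ := (Equiv.sumCongr (splitE (Fin.last n) J)
        (splitE (Fin.last n) J')).surjective i
      have e := Equiv.symm_apply_apply (Equiv.sumCongr (splitE (Fin.last n) J)
        (splitE (Fin.last n) J')) i
      simp only [Equiv.trans_apply, e]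
      rcases i with (i | i) | (i | i) <;> simp

theorem IP.of_eq {ι : Type*} {x : ι → I → P.Col} {y : ι → J → P.Col}
    (f : ∀ i, P.HF (x i) (y i)) {i j : ι} (h : i = j) :
    IP (Equiv.refl _) (Equiv.refl _) (f i) (f j) := by
  subst h; exact IP.refl _

/-- Splitting off an arbitrary factor. -/
theorem IP.extract {n : ℕ} {x : Fin (n + 1) → I → P.Col} {y : Fin (n + 1) → J → P.Col}
    (f : ∀ i, P.HF (x i) (y i)) (k : Fin (n + 1)) :
    IP (splitE k I) (splitE k J)
      (hF (prodF fun i => f (k.succAbove i)) (f k)) (prodF f) := by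
  have last : ∀ (n : ℕ) {x : Fin (n + 1) → I → P.Col} {y : Fin (n + 1) → J → P.Col}
      (f : ∀ i, P.HF (x i) (y i)), IP (splitE (Fin.last n) I) (splitE (Fin.last n) J)
      (hF (prodF fun i => f ((Fin.last n).succAbove i)) (f (Fin.last n))) (prodF f) := by
    intro n x y f
    have h : ∀ i : Fin n, IP (Equiv.refl _) (Equiv.refl _)
        (f ((Fin.last n).succAbove i)) (f i.castSucc) := fun i => IP.of_eq f (by simp)
    exact (((IP.prod h).h (IP.refl _)).trans (IP.succ f)).congr
      (by rintro (i | i) <;> simp) (by rintro (i | i) <;> simp)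
  induction n with
  | zero =>
    obtain rfl : k = Fin.last 0 := Fin.ext (by omega)
    exact last 0 f
  | succ n ih =>
    rcases Fin.eq_castSucc_or_eq_last k with ⟨j, rfl⟩ | rfl
    · have h1 := IP.succ (fun i => f (j.castSucc.succAbove i))
      have h2 := ih (fun i => f i.castSucc) j
      have h3 := IP.succ f
      have e1 : ∀ i : Fin n, IP (Equiv.refl _) (Equiv.refl _)
          (f (j.castSucc.succAbove i.castSucc)) (f (j.succAbove i).castSucc) :=
        fun i => IP.of_eq f (by simp)
      have e2 : IP (Equiv.refl _) (Equiv.refl _)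
          (f (j.castSucc.succAbove (Fin.last n))) (f (Fin.last (n + 1))) :=
        IP.of_eq f (by simp)
      have c := (h1.h (IP.refl (f j.castSucc))).symm.trans
        ((((IP.prod e1).h e2).h (IP.refl _)).trans
          (((IP.assoc _ _ _).trans ((IP.refl _).h (IP.comm _ _))).trans
            ((IP.assoc _ _ _).symm.trans ((h2.h (IP.refl _)).trans h3))))
      refine c.congr (fun i => ?_) (fun i => ?_)
      · obtain ⟨i, rfl⟩ := (Equiv.sumCongr (splitE (Fin.last n) I) (Equiv.refl I)).surjective i
        have e := Equiv.symm_apply_apply (Equiv.sumCongr (splitE (Fin.last n) I) (Equiv.refl I)) i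
        simp only [Equiv.trans_apply, e]
        rcases i with (i | i) | i <;> simp
      · obtain ⟨i, rfl⟩ := (Equiv.sumCongr (splitE (Fin.last n) J) (Equiv.refl J)).surjective i
        have e := Equiv.symm_apply_apply (Equiv.sumCongr (splitE (Fin.last n) J) (Equiv.refl J)) i
        simp only [Equiv.trans_apply, e]
        rcases i with (i | i) | i <;> simp
    · exact last _ f

/-- Horizontal composites do not depend on the order of the factors, up to permutation. -/
theorem IP.perm {n n' : ℕ} (σ : Fin n' ≃ Fin n) {x : Fin n → I → P.Col} {y : Fin n → J → P.Col}
    {x' : Fin n' → I → P.Col} {y' : Fin n' → J → P.Col}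
    (f : ∀ i, P.HF (x i) (y i)) (f' : ∀ i, P.HF (x' i) (y' i))
    (h : ∀ i, IP (Equiv.refl _) (Equiv.refl _) (f' i) (f (σ i))) :
    IP (Equiv.prodCongr σ (Equiv.refl _)) (Equiv.prodCongr σ (Equiv.refl _))
      (prodF f') (prodF f) := by
  obtain rfl : n' = n := by simpa using Fintype.card_congr σ
  induction n' with
  | zero =>
    exact ((IP.zero Fin.elim0 Fin.elim0 f').symm.trans (IP.zero Fin.elim0 Fin.elim0 f)).congr
      (fun i => i.1.elim0) (fun i => i.1.elim0)
  | succ n ih =>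
    set k := σ (Fin.last n) with hk
    have hne : ∀ i : Fin n, σ i.castSucc ≠ k := fun i hi =>
      (Fin.castSucc_lt_last i).ne (σ.injective hi)
    choose τ hτ using fun i : Fin n => Fin.exists_succAbove_eq (hne i)
    have hτi : Function.Injective τ := by
      intro i j hij
      have : σ i.castSucc = σ j.castSucc := by rw [← hτ, ← hτ, hij]
      exact Fin.castSucc_injective _ (σ.injective this)
    let ρ : Fin n ≃ Fin n := Equiv.ofBijective τ (Finite.injective_iff_bijective.mp hτi)
    have hρ : ∀ i, k.succAbove (ρ i) = σ i.castSucc := hτ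
    have h1 := ih (σ := ρ) (f := fun i => f (k.succAbove i)) (f' := fun i => f' i.castSucc) (h := fun i => by
      exact ((h i.castSucc).trans (IP.of_eq f (hρ i).symm)).congr (fun _ => rfl) (fun _ => rfl))
    have c := (IP.succ f').symm.trans ((h1.h (h (Fin.last n))).trans (IP.extract f k))
    refine c.congr (fun i => ?_) (fun i => ?_)
    · obtain ⟨i, rfl⟩ := (splitE (Fin.last n) I).surjective i
      simp only [Equiv.trans_apply, Equiv.symm_apply_apply]
      rcases i with i | i
      · simpa using hρ i.1
      · simp [hk]
    · obtain ⟨i, rfl⟩ := (splitE (Fin.last n) J).surjective i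
      simp only [Equiv.trans_apply, Equiv.symm_apply_apply]
      rcases i with i | i
      · simpa using hρ i.1
      · simp [hk]

/-- `Fin (n + m) × I` as a sum. -/
def appE (n m : ℕ) (I : Type) : (Fin n × I) ⊕ (Fin m × I) ≃ Fin (n + m) × I :=
  (Equiv.sumProdDistrib _ _ _).symm.trans (Equiv.prodCongr finSumFinEquiv (Equiv.refl _))

@[simp] theorem appE_inl (n m : ℕ) (s : Fin n × I) :
    appE n m I (Sum.inl s) = (Fin.castAdd m s.1, s.2) := rfl
@[simp] theorem appE_inr (n m : ℕ) (s : Fin m × I) :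
    appE n m I (Sum.inr s) = (Fin.natAdd n s.1, s.2) := rfl

theorem IP.append {n m : ℕ} {x : Fin n → I → P.Col} {y : Fin n → J → P.Col}
    {x' : Fin m → I → P.Col} {y' : Fin m → J → P.Col}
    {x'' : Fin (n + m) → I → P.Col} {y'' : Fin (n + m) → J → P.Col}
    (f : ∀ i, P.HF (x i) (y i)) (f' : ∀ i, P.HF (x' i) (y' i)) (f'' : ∀ i, P.HF (x'' i) (y'' i))
    (h : ∀ i, IP (Equiv.refl _) (Equiv.refl _) (f i) (f'' (Fin.castAdd m i)))
    (h' : ∀ i, IP (Equiv.refl _) (Equiv.refl _) (f' i) (f'' (Fin.natAdd n i))) :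
    IP (appE n m I) (appE n m J) (hF (prodF f) (prodF f')) (prodF f'') := by
  induction m with
  | zero =>
    have c := (((IP.refl (prodF f)).h (IP.zero Fin.elim0 Fin.elim0 f')).symm.trans
      (IP.hFu _ _ _)).trans (IP.prod h)
    exact c.congr (by rintro (i | i); · rfl
                      · exact i.1.elim0) (by rintro (i | i); · rfl
                                             · exact i.1.elim0)
  | succ m ih =>
    have h1 := ih (fun i => f' i.castSucc) (fun i => f'' i.castSucc) h (fun i => h' i.castSucc)
    have c := ((IP.refl (prodF f)).h (IP.succ f')).symm.trans
      ((IP.assoc _ _ _).symm.trans ((h1.h (h' (Fin.last m))).trans (IP.succ f'')))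
    refine c.congr (fun i => ?_) (fun i => ?_)
    · obtain ⟨i, rfl⟩ := (Equiv.sumCongr (Equiv.refl (Fin n × I))
        (splitE (Fin.last m) I)).surjective i
      have e := Equiv.symm_apply_apply (Equiv.sumCongr (Equiv.refl (Fin n × I))
        (splitE (Fin.last m) I)) i
      simp only [Equiv.trans_apply, e]
      rcases i with i | (i | i) <;> simp [Fin.ext_iff]
    · obtain ⟨i, rfl⟩ := (Equiv.sumCongr (Equiv.refl (Fin n × J))
        (splitE (Fin.last m) J)).surjective i
      have e := Equiv.symm_apply_apply (Equiv.sumCongr (Equiv.refl (Fin n × J))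
        (splitE (Fin.last m) J)) i
      simp only [Equiv.trans_apply, e]
      rcases i with i | (i | i) <;> simp [Fin.ext_iff]

/-! Identities. -/

theorem IP.id (s : I ≃ I') (h : ∀ i, a' (s i) = a i) : IP s s (idF a) (idF a') :=
  ⟨h, h, push_id s h h⟩

theorem IP.one {x : Fin 1 → I → P.Col} {y : Fin 1 → J → P.Col} (f : ∀ i, P.HF (x i) (y i)) :
    IP (Equiv.uniqueProd I (Fin 1)) (Equiv.uniqueProd J (Fin 1)) (prodF f) (f 0) := by
  have c := (IP.succ f).symm.trans (((IP.zero Fin.elim0 Fin.elim0 _).symm.h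
    (IP.refl (f (Fin.last 0)))).trans (IP.uhF _ _ _))
  refine c.congr (fun i => ?_) (fun i => ?_)
  · obtain ⟨i, rfl⟩ := (splitE (Fin.last 0) I).surjective i
    simp only [Equiv.trans_apply, Equiv.symm_apply_apply]
    rcases i with i | i
    · exact i.1.elim0
    · rfl
  · obtain ⟨i, rfl⟩ := (splitE (Fin.last 0) J).surjective i
    simp only [Equiv.trans_apply, Equiv.symm_apply_apply]
    rcases i with i | i
    · exact i.1.elim0
    · rfl

/-- `P.id` as an operation on one-element lists. -/
def id1 (c : P.Col) : P.HF (fun _ : Fin 1 => c) (fun _ : Fin 1 => c) := P.id c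

theorem IP.idList {n : ℕ} (a : Fin n → P.Col) :
    IP (Equiv.prodUnique (Fin n) (Fin 1)) (Equiv.prodUnique (Fin n) (Fin 1))
      (CProp.prodF fun i => id1 (a i)) (idF a) := by
  refine ⟨fun _ => rfl, fun _ => rfl, ?_⟩
  refine re_congr _ _ _ _ _ (Equiv.ext fun i => ?_) (Equiv.ext fun i => ?_) <;>
  · ext
    simp [Enm.e]
    exact Nat.one_mul _

theorem id1_eq (c : P.Col) : id1 c = idF (fun _ : Fin 1 => c) :=
  IP.unique (IP.one fun _ : Fin 1 => id1 c) (IP.idList fun _ : Fin 1 => c)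
    (fun _ => Subsingleton.elim _ _) (fun _ => Subsingleton.elim _ _)

theorem hF_id (a : I → P.Col) (c : K → P.Col) : hF (idF a) (idF c) = idF (Sum.elim a c) := by
  have h1 := IP.append (fun i => id1 (a ((Enm.e (I := I)).symm i)))
    (fun i => id1 (c ((Enm.e (I := K)).symm i)))
    (fun i => id1 (Fin.append (fun i => a ((Enm.e (I := I)).symm i))
      (fun i => c ((Enm.e (I := K)).symm i)) i))
    (fun i => IP.of_eq (P := P) id1 (Fin.append_left (fun i => a ((Enm.e (I := I)).symm i))
      (fun i => c ((Enm.e (I := K)).symm i)) i).symm)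
    (fun i => IP.of_eq (P := P) id1 (Fin.append_right (fun i => a ((Enm.e (I := I)).symm i))
      (fun i => c ((Enm.e (I := K)).symm i)) i).symm)
  have h2 := ((IP.idList fun i => a ((Enm.e (I := I)).symm i)).h
    (IP.idList fun i => c ((Enm.e (I := K)).symm i))).symm.trans (h1.trans (IP.idList _))
  have h3 := ((IP.id (a := a) (a' := fun i => a ((Enm.e (I := I)).symm i)) Enm.e
    (fun i => by simp)).h (IP.id (a := c) (a' := fun i => c ((Enm.e (I := K)).symm i)) Enm.e
    (fun i => by simp))).trans h2
  have h4 := IP.id (a := Sum.elim a c) (a' := Fin.append (fun i => a ((Enm.e (I := I)).symm i))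
      (fun i => c ((Enm.e (I := K)).symm i)))
    ((Equiv.sumCongr Enm.e Enm.e).trans finSumFinEquiv) (by rintro (i | i) <;> simp)
  refine IP.unique h3.symm h4.symm ?_ ?_ <;>
  · intro i
    apply ((Equiv.sumCongr Enm.e Enm.e).trans finSumFinEquiv).injective
    rw [Equiv.apply_symm_apply]
    obtain ⟨i, rfl⟩ := ((Equiv.sumCongr (Enm.e (I := I)) (Enm.e (I := K))).trans
      finSumFinEquiv).surjective i
    congr 1
    rw [Equiv.symm_apply_eq]
    rcases i with i | i <;> rfl

theorem prodF_id {n : ℕ} (x : Fin n → I → P.Col) : prodF (fun i => idF (x i)) = idF (G x) := by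
  induction n with
  | zero =>
    have h := IP.zero (Fin.elim0 : Fin 0 → P.Col) Fin.elim0 (fun i => idF (x i))
    rw [IP.uF_id] at h
    exact IP.unique h (IP.id _ fun i => i.elim0) (fun _ => rfl) (fun _ => rfl)
  | succ n ih =>
    have h := IP.succ (fun i => idF (x i))
    rw [ih, hF_id] at h
    exact IP.unique h (IP.id _ (by rintro (i | i) <;> simp)) (fun _ => rfl) (fun _ => rfl)

theorem prodF_uF {n : ℕ} (x y : Fin n → Fin 0 → P.Col) :
    IP (Equiv.equivOfIsEmpty _ _) (Equiv.equivOfIsEmpty _ _)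
      (P.uF Fin.elim0 Fin.elim0) (prodF fun i => P.uF (x i) (y i)) := by
  induction n with
  | zero => exact (IP.zero _ _ _).congr (fun i => i.elim0) (fun i => i.elim0)
  | succ n ih =>
    exact (((IP.uhF Fin.elim0 Fin.elim0 (P.uF Fin.elim0 Fin.elim0)).symm.trans
      ((ih _ _).h (IP.u Fin.elim0 Fin.elim0 _ _ (Equiv.refl _) (Equiv.refl _)))).trans
        (IP.succ fun i => P.uF (x i) (y i))).congr (fun i => i.elim0) (fun i => i.elim0)

/-! Octagons. -/

theorem IP.permIn {n n' m : ℕ} {a : Fin n → P.Col} {a' : Fin n' → P.Col} {b : Fin m → P.Col}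
    (σ : Fin n' ≃ Fin n) (h : ∀ i, a' i = a (σ i)) (f : P.Hom a b) :
    IP (I := Fin n) (I' := Fin n') (J := Fin m) (J' := Fin m) (a := a) (b := b) (a' := a')
      (b' := b) σ.symm (Equiv.refl _) f (P.permIn σ h f) := by
  refine ⟨fun i => by simp [h], fun _ => rfl, ?_⟩
  exact (permIn_eq_re σ h f).symm

theorem IP.permOut {n m m' : ℕ} {a : Fin n → P.Col} {b : Fin m → P.Col} {b' : Fin m' → P.Col}
    (τ : Fin m ≃ Fin m') (h : ∀ k, b' k = b (τ.symm k)) (f : P.Hom a b) :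
    IP (I := Fin n) (I' := Fin n) (J := Fin m) (J' := Fin m') (a := a) (b := b) (a' := a)
      (b' := b') (Equiv.refl _) τ f (P.permOut τ h f) := by
  refine ⟨fun _ => rfl, fun i => by simp [h], ?_⟩
  exact (permOut_eq_re τ h f).symm

theorem IP.recast {n m : ℕ} {a a' : Fin n → P.Col} {b b' : Fin m → P.Col}
    (h : ∀ i, a' i = a i) (h' : ∀ k, b' k = b k) (f : P.Hom a b) :
    IP (I := Fin n) (I' := Fin n) (J := Fin m) (J' := Fin m) (a := a) (b := b) (a' := a')
      (b' := b') (Equiv.refl _) (Equiv.refl _) f (P.recast h h' f) :=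
  ⟨fun i => h i, fun i => h' i, rfl⟩

theorem IP.re {n n' m m' : ℕ} {a : Fin n → P.Col} {b : Fin m → P.Col} {a' : Fin n' → P.Col}
    {b' : Fin m' → P.Col} (σ : Fin n' ≃ Fin n) (τ : Fin m' ≃ Fin m)
    (h : ∀ i, a' i = a (σ i)) (h' : ∀ k, b' k = b (τ k)) (f : P.Hom a b) :
    IP (I := Fin n) (I' := Fin n') (J := Fin m) (J' := Fin m') (a := a) (b := b) (a' := a')
      (b' := b') σ.symm τ.symm f (P.re σ τ h h' f) :=
  ⟨fun i => by simp [h], fun i => by simp [h'], rfl⟩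

theorem IP.hcomp {n m p q : ℕ} {a : Fin n → P.Col} {b : Fin m → P.Col}
    {c : Fin p → P.Col} {d : Fin q → P.Col} (f : P.Hom a b) (g : P.Hom c d) :
    IP (I := Fin n ⊕ Fin p) (I' := Fin (n + p)) (J := Fin m ⊕ Fin q) (J' := Fin (m + q))
      (a := Sum.elim a c) (b := Sum.elim b d) (a' := Fin.append a c) (b' := Fin.append b d)
      finSumFinEquiv finSumFinEquiv
      (hF (I := Fin n) (J := Fin m) (K := Fin p) (I' := Fin q) f g) (P.hcomp f g) := by
  refine ⟨by rintro (i | i) <;> simp, by rintro (i | i) <;> simp, ?_⟩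
  refine (re_re _ _ _ _ _ _ _ _ _).trans ((re_congr _ _ _ _ _ ?_ ?_).trans (re_refl _))
  · refine e_ext (I := Fin n ⊕ Fin p) fun z => ?_
    have e := Equiv.symm_apply_apply (Enm.e (I := Fin n ⊕ Fin p)) z
    refine (congrArg finSumFinEquiv e).trans ?_
    rcases z with z | z <;> rfl
  · refine e_ext (I := Fin m ⊕ Fin q) fun z => ?_
    have e := Equiv.symm_apply_apply (Enm.e (I := Fin m ⊕ Fin q)) z
    refine (congrArg finSumFinEquiv e).trans ?_
    rcases z with z | z <;> rfl

theorem IP.hprod {n p q : ℕ} {x : Fin n → Fin p → P.Col} {y : Fin n → Fin q → P.Col}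
    (f : ∀ i, P.Hom (x i) (y i)) :
    IP (I := Fin n × Fin p) (I' := Fin (n * p)) (J := Fin n × Fin q) (J' := Fin (n * q))
      (a := G x) (b := G y) (a' := grid x) (b' := grid y) finProdFinEquiv finProdFinEquiv
      (CProp.prodF (I := Fin p) (J := Fin q) f) (P.hprod f) := by
  refine ⟨fun s => ?_, fun s => ?_, ?_⟩
  · exact congrArg (G x) (finProdFinEquiv.symm_apply_apply s)
  · exact congrArg (G y) (finProdFinEquiv.symm_apply_apply s)
  · refine (re_congr _ _ _ _ _ ?_ ?_).trans (re_refl _)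
    · exact Equiv.ext fun i => finProdFinEquiv.apply_symm_apply i
    · exact Equiv.ext fun i => finProdFinEquiv.apply_symm_apply i

/-- Interchanging rows and columns. -/
def swF {n m p q : ℕ} {x : Fin n → Fin p → P.Col} {y : Fin m → Fin q → P.Col}
    (f : P.HF (G x) (G y)) : P.HF (G fun j i => x i j) (G fun l k => y k l) :=
  push (Equiv.prodComm _ _) (Equiv.prodComm _ _) (fun _ => rfl) (fun _ => rfl) f

theorem IP.sw {n m p q : ℕ} {x : Fin n → Fin p → P.Col} {y : Fin m → Fin q → P.Col}
    (f : P.HF (G x) (G y)) : IP (Equiv.prodComm _ _) (Equiv.prodComm _ _) f (swF f) :=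
  ⟨fun _ => rfl, fun _ => rfl, rfl⟩

section oct
variable {n m p q : ℕ} {x : Fin n → Fin p → P.Col} {y : Fin n → Fin q → P.Col}
  {z : Fin m → Fin p → P.Col} {w : Fin m → Fin q → P.Col}

/-- Commutativity of an octagon. -/
def OctF (top : ∀ i, P.HF (x i) (y i))
    (right : ∀ l, P.HF (fun i => y i l) (fun k => w k l))
    (left : ∀ j, P.HF (fun i => x i j) (fun k => z k j))
    (bottom : ∀ k, P.HF (z k) (w k)) : Prop :=
  vF (swF (prodF right)) (prodF top) = vF (prodF bottom) (swF (prodF left))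

theorem octUpper_IP (top : ∀ i, P.Hom (x i) (y i))
    (right : ∀ l, P.Hom (fun i => y i l) (fun k => w k l)) :
    IP (I := Fin n × Fin p) (I' := Fin (n * p)) (J := Fin m × Fin q) (J' := Fin (m * q))
      (a := G x) (b := G w) (a' := grid x) (b' := grid w) finProdFinEquiv finProdFinEquiv
      (vF (swF (x := fun l i => y i l) (y := fun l k => w k l)
        (prodF (I := Fin n) (J := Fin m) right)) (prodF (I := Fin p) (J := Fin q) top))
      (octUpper top right) := by
  have h1 := ((IP.sw (x := fun l i => y i l) (y := fun l k => w k l)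
      (prodF (I := Fin n) (J := Fin m) right)).symm.trans (IP.hprod right)).trans
    (IP.permOut (gridSwap q m) (grid_swap w) (P.hprod right))
  have h2 := (IP.hprod top).trans
    (IP.permOut (gridSwap n q) (grid_swap fun l i => y i l) (P.hprod top))
  have h1' := h1.congr (s' := (Equiv.prodComm _ _).trans finProdFinEquiv) (t' := finProdFinEquiv)
    (fun i => rfl) (fun i => by simp [gridSwap])
  have h2' := h2.congr (t' := (Equiv.prodComm _ _).trans finProdFinEquiv) (s' := finProdFinEquiv)
    (fun i => rfl) (fun i => by simp [gridSwap])
  exact IP.v h1' h2'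

theorem octLower_IP (left : ∀ j, P.Hom (fun i => x i j) (fun k => z k j))
    (bottom : ∀ k, P.Hom (z k) (w k)) :
    IP (I := Fin n × Fin p) (I' := Fin (n * p)) (J := Fin m × Fin q) (J' := Fin (m * q))
      (a := G x) (b := G w) (a' := grid x) (b' := grid w) finProdFinEquiv finProdFinEquiv
      (vF (prodF (I := Fin p) (J := Fin q) bottom) (swF (x := fun j i => x i j) (y := fun j k => z k j)
        (prodF (I := Fin n) (J := Fin m) left)))
      (octLower left bottom) := by
  have h1 := (IP.hprod bottom).trans
    (IP.permIn (gridSwap p m) (grid_swap fun j k => z k j) (P.hprod bottom))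
  have h2 := ((IP.sw (x := fun j i => x i j) (y := fun j k => z k j)
      (prodF (I := Fin n) (J := Fin m) left)).symm.trans (IP.hprod left)).trans
    (IP.permIn (gridSwap n p) (grid_swap x) (P.hprod left))
  have h1' := h1.congr (s' := (Equiv.prodComm _ _).trans finProdFinEquiv) (t' := finProdFinEquiv)
    (fun i => by simp [gridSwap]) (fun i => rfl)
  have h2' := h2.congr (s' := finProdFinEquiv) (t' := (Equiv.prodComm _ _).trans finProdFinEquiv)
    (fun i => by simp [gridSwap]) (fun i => rfl)
  exact IP.v h1' h2'

theorem oct_iff (top : ∀ i, P.Hom (x i) (y i))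
    (right : ∀ l, P.Hom (fun i => y i l) (fun k => w k l))
    (left : ∀ j, P.Hom (fun i => x i j) (fun k => z k j))
    (bottom : ∀ k, P.Hom (z k) (w k)) :
    octUpper top right = octLower left bottom ↔ OctF top right left bottom := by
  have h1 := octUpper_IP top right
  have h2 := octLower_IP left bottom
  constructor
  · intro h
    rw [h] at h1
    exact IP.unique h1.symm h2.symm (fun _ => rfl) (fun _ => rfl)
  · intro h
    unfold OctF at h
    rw [h] at h1
    exact IP.unique h1 h2 (fun _ => rfl) (fun _ => rfl)

variable {top : ∀ i, P.HF (x i) (y i)}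
  {right : ∀ l, P.HF (fun i => y i l) (fun k => w k l)}
  {left : ∀ j, P.HF (fun i => x i j) (fun k => z k j)}
  {bottom : ∀ k, P.HF (z k) (w k)}

theorem OctF.transpose (h : OctF top right left bottom) : OctF left bottom top right := by
  unfold OctF at h ⊢
  have h1 := IP.v (IP.sw (swF (prodF right))) (IP.sw (prodF top))
  have h2 := IP.v (IP.sw (prodF bottom)) (IP.sw (swF (prodF left)))
  have e1 : swF (swF (prodF right)) = prodF right :=
    IP.unique ((IP.sw _).trans (IP.sw _)) (IP.refl _) (fun _ => rfl) (fun _ => rfl)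
  have e2 : swF (swF (prodF left)) = prodF left :=
    IP.unique ((IP.sw _).trans (IP.sw _)) (IP.refl _) (fun _ => rfl) (fun _ => rfl)
  rw [e1, h] at h1
  rw [e2] at h2
  exact IP.unique h2 h1 (fun _ => rfl) (fun _ => rfl)

theorem OctF.v {r : ℕ} {y' : Fin n → Fin r → P.Col} {w' : Fin m → Fin r → P.Col}
    {top' : ∀ i, P.HF (y i) (y' i)} {bottom' : ∀ k, P.HF (w k) (w' k)}
    {right' : ∀ l, P.HF (fun i => y' i l) (fun k => w' k l)}
    (h : OctF top right left bottom) (h' : OctF top' right' right bottom') :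
    OctF (fun i => vF (top' i) (top i)) right' left (fun k => vF (bottom' k) (bottom k)) := by
  unfold OctF at h h' ⊢
  rw [prodF_vF, prodF_vF, ← vF_assoc, h', vF_assoc, h, ← vF_assoc]

theorem OctF.id {a : Fin n → P.Col} {b : Fin m → P.Col} (φ : P.Hom a b) :
    OctF (x := fun i (_ : Fin 1) => a i) (w := fun k (_ : Fin 1) => b k)
      (z := fun k (_ : Fin 1) => b k)
      (fun i => id1 (a i)) (fun _ => φ) (fun _ => φ) (fun k => id1 (b k)) := by
  unfold OctF
  simp only [id1_eq]
  rw [prodF_id, prodF_id]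
  exact (vF_id _).trans (id_vF _).symm

theorem OctF.unit {n m : ℕ} {x y : Fin n → Fin 0 → P.Col} {z w : Fin m → Fin 0 → P.Col}
    {right : ∀ l, P.HF (fun i => y i l) (fun k => w k l)}
    {left : ∀ j, P.HF (fun i => x i j) (fun k => z k j)} :
    OctF (fun i => P.uF (x i) (y i)) right left (fun k => P.uF (z k) (w k)) := by
  have h1 := prodF_uF x y
  have h2 := prodF_uF z w
  have h3 := (IP.zero (P := P) (Fin.elim0) Fin.elim0 right).trans (IP.sw _)
  have h4 := (IP.zero (P := P) (Fin.elim0) Fin.elim0 left).trans (IP.sw _)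
  exact IP.unique
    (IP.v (h3.congr (s' := Equiv.equivOfIsEmpty _ _) (t' := Equiv.equivOfIsEmpty _ _)
      (fun i => i.elim0) (fun i => i.elim0)) h1)
    (IP.v h2 (h4.congr (s' := Equiv.equivOfIsEmpty _ _) (t' := Equiv.equivOfIsEmpty _ _)
      (fun i => i.elim0) (fun i => i.elim0))) (fun i => i.elim0) (fun i => i.elim0)

theorem OctF.h {p' q' : ℕ} {x' : Fin n → Fin p' → P.Col} {y' : Fin n → Fin q' → P.Col}
    {z' : Fin m → Fin p' → P.Col} {w' : Fin m → Fin q' → P.Col}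
    {top' : ∀ i, P.HF (x' i) (y' i)}
    {right' : ∀ l, P.HF (fun i => y' i l) (fun k => w' k l)}
    {left' : ∀ j, P.HF (fun i => x' i j) (fun k => z' k j)}
    {bottom' : ∀ k, P.HF (z' k) (w' k)}
    {x'' : Fin n → Fin (p + p') → P.Col} {y'' : Fin n → Fin (q + q') → P.Col}
    {z'' : Fin m → Fin (p + p') → P.Col} {w'' : Fin m → Fin (q + q') → P.Col}
    (top'' : ∀ i, P.HF (x'' i) (y'' i))
    (right'' : ∀ l, P.HF (fun i => y'' i l) (fun k => w'' k l))
    (left'' : ∀ j, P.HF (fun i => x'' i j) (fun k => z'' k j))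
    (bottom'' : ∀ k, P.HF (z'' k) (w'' k))
    (h : OctF top right left bottom) (h' : OctF top' right' left' bottom')
    (ht : ∀ i, IP finSumFinEquiv finSumFinEquiv (hF (top i) (top' i)) (top'' i))
    (hb : ∀ k, IP finSumFinEquiv finSumFinEquiv (hF (bottom k) (bottom' k)) (bottom'' k))
    (hr : ∀ l, IP (Equiv.refl _) (Equiv.refl _) (right l) (right'' (Fin.castAdd q' l)))
    (hr' : ∀ l, IP (Equiv.refl _) (Equiv.refl _) (right' l) (right'' (Fin.natAdd q l)))
    (hl : ∀ l, IP (Equiv.refl _) (Equiv.refl _) (left l) (left'' (Fin.castAdd p' l)))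
    (hl' : ∀ l, IP (Equiv.refl _) (Equiv.refl _) (left' l) (left'' (Fin.natAdd p l))) :
    OctF top'' right'' left'' bottom'' := by
  unfold OctF at h h' ⊢
  have t := (IP.prod_hF top top').trans (IP.prod ht)
  have b := (IP.prod_hF bottom bottom').trans (IP.prod hb)
  have r := ((IP.sw (prodF right)).h (IP.sw (prodF right'))).symm.trans
    ((IP.append right right' right'' hr hr').trans (IP.sw _))
  have l := ((IP.sw (prodF left)).h (IP.sw (prodF left'))).symm.trans
    ((IP.append left left' left'' hl hl').trans (IP.sw _))
  have r' := r.congr (s' := (distE n (Fin q) (Fin q')).trans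
      (Equiv.prodCongr (Equiv.refl _) finSumFinEquiv)) (t' := (distE m (Fin q) (Fin q')).trans
      (Equiv.prodCongr (Equiv.refl _) finSumFinEquiv))
    (by rintro (i | i) <;> rfl) (by rintro (i | i) <;> rfl)
  have l' := l.congr (s' := (distE n (Fin p) (Fin p')).trans
      (Equiv.prodCongr (Equiv.refl _) finSumFinEquiv)) (t' := (distE m (Fin p) (Fin p')).trans
      (Equiv.prodCongr (Equiv.refl _) finSumFinEquiv))
    (by rintro (i | i) <;> rfl) (by rintro (i | i) <;> rfl)
  have u := IP.v r' t
  have v := IP.v b l'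
  rw [← hF_interchange, h, h', hF_interchange] at u
  exact IP.unique u v (fun _ => rfl) (fun _ => rfl)

theorem OctF.perm {p' q' : ℕ} {x' : Fin n → Fin p' → P.Col} {y' : Fin n → Fin q' → P.Col}
    {z' : Fin m → Fin p' → P.Col} {w' : Fin m → Fin q' → P.Col}
    (top' : ∀ i, P.HF (x' i) (y' i))
    (right' : ∀ l, P.HF (fun i => y' i l) (fun k => w' k l))
    (left' : ∀ j, P.HF (fun i => x' i j) (fun k => z' k j))
    (bottom' : ∀ k, P.HF (z' k) (w' k)) (σ : Fin p ≃ Fin p') (τ : Fin q ≃ Fin q')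
    (h : OctF top right left bottom)
    (ht : ∀ i, IP σ τ (top i) (top' i)) (hb : ∀ k, IP σ τ (bottom k) (bottom' k))
    (hr : ∀ l, IP (Equiv.refl _) (Equiv.refl _) (right l) (right' (τ l)))
    (hl : ∀ l, IP (Equiv.refl _) (Equiv.refl _) (left l) (left' (σ l))) :
    OctF top' right' left' bottom' := by
  unfold OctF at h ⊢
  have t := IP.prod ht
  have b := IP.prod hb
  have r := (IP.sw (prodF right)).symm.trans ((IP.perm τ right' right hr).trans (IP.sw _))
  have l := (IP.sw (prodF left)).symm.trans ((IP.perm σ left' left hl).trans (IP.sw _))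
  have r' := r.congr (s' := Equiv.prodCongr (Equiv.refl _) τ)
    (t' := Equiv.prodCongr (Equiv.refl _) τ) (fun _ => rfl) (fun _ => rfl)
  have l' := l.congr (s' := Equiv.prodCongr (Equiv.refl _) σ)
    (t' := Equiv.prodCongr (Equiv.refl _) σ) (fun _ => rfl) (fun _ => rfl)
  have u := IP.v r' t
  have v := IP.v b l'
  rw [h] at u
  exact IP.unique u v (fun _ => rfl) (fun _ => rfl)

end oct

end

end CProp

open CProp

namespace MapLaws

variable {D : PropData.{u}} {T : CProp.{u}} {col : D.Col → T.Col}
  {map : ∀ {n m : ℕ} {a : Fin n → D.Col} {b : Fin m → D.Col},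
      D.Hom a b → T.Hom (fun i => col (a i)) (fun k => col (b k))}

/-- The value of a map on an operation. -/
abbrev ap (_ : MapLaws D T.toPropData (eqRel T.toPropData) col map) {n m : ℕ}
    {a : Fin n → D.Col} {b : Fin m → D.Col} (f : D.Hom a b) :
    T.HF (fun i => col (a i)) (fun k => col (b k)) := map f


theorem ap_permIn (M : MapLaws D T.toPropData (eqRel T.toPropData) col map)
    {n n' m : ℕ} {a : Fin n → D.Col} {a' : Fin n' → D.Col} {b : Fin m → D.Col}
    (σ : Fin n' ≃ Fin n) (h : ∀ i, a' i = a (σ i)) (f : D.Hom a b) :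
    IP σ.symm (Equiv.refl _) (M.ap f) (M.ap (D.permIn σ h f)) := by
  obtain ⟨h1, h2, h3⟩ := IP.permIn (P := T) σ (fun i => congrArg col (h i)) (map f)
  exact ⟨h1, h2, h3.trans (M.map_permIn σ h f).symm⟩

theorem ap_permOut (M : MapLaws D T.toPropData (eqRel T.toPropData) col map)
    {n m m' : ℕ} {a : Fin n → D.Col} {b : Fin m → D.Col} {b' : Fin m' → D.Col}
    (τ : Fin m ≃ Fin m') (h : ∀ k, b' k = b (τ.symm k)) (f : D.Hom a b) :
    IP (Equiv.refl _) τ (M.ap f) (M.ap (D.permOut τ h f)) := by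
  obtain ⟨h1, h2, h3⟩ := IP.permOut (P := T) τ (fun i => congrArg col (h i)) (map f)
  exact ⟨h1, h2, h3.trans (M.map_permOut τ h f).symm⟩

theorem ap_re (M : MapLaws D T.toPropData (eqRel T.toPropData) col map)
    {n n' m m' : ℕ} {a : Fin n → D.Col} {b : Fin m → D.Col} {a' : Fin n' → D.Col}
    {b' : Fin m' → D.Col} (σ : Fin n' ≃ Fin n) (τ : Fin m' ≃ Fin m)
    (h : ∀ i, a' i = a (σ i)) (h' : ∀ k, b' k = b (τ k)) (f : D.Hom a b) :
    IP σ.symm τ.symm (M.ap f) (M.ap (D.re σ τ h h' f)) :=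
  (M.ap_permOut τ.symm h' f).trans (M.ap_permIn σ h _)

theorem ap_recast (M : MapLaws D T.toPropData (eqRel T.toPropData) col map)
    {n m : ℕ} {a a' : Fin n → D.Col} {b b' : Fin m → D.Col}
    (h : ∀ i, a' i = a i) (h' : ∀ k, b' k = b k) (f : D.Hom a b) :
    IP (Equiv.refl _) (Equiv.refl _) (M.ap f) (M.ap (D.recast h h' f)) :=
  M.ap_re (Equiv.refl _) (Equiv.refl _) h h' f

theorem ap_vcomp (M : MapLaws D T.toPropData (eqRel T.toPropData) col map)
    {n m k : ℕ} {a : Fin n → D.Col} {b : Fin m → D.Col} {c : Fin k → D.Col}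
    (f : D.Hom b c) (g : D.Hom a b) : M.ap (D.vcomp f g) = vF (M.ap f) (M.ap g) :=
  M.map_vcomp f g

theorem ap_unit (M : MapLaws D T.toPropData (eqRel T.toPropData) col map)
    : M.ap D.unit = T.uF _ _ := M.map_unit

theorem ap_hcomp (M : MapLaws D T.toPropData (eqRel T.toPropData) col map)
    {n m p q : ℕ} {a : Fin n → D.Col} {b : Fin m → D.Col}
    {c : Fin p → D.Col} {d : Fin q → D.Col} (f : D.Hom a b) (g : D.Hom c d) :
    IP finSumFinEquiv finSumFinEquiv (hF (M.ap f) (M.ap g)) (M.ap (D.hcomp f g)) := by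
  obtain ⟨h1, h2, h3⟩ := (IP.hcomp (P := T) (map f) (map g)).trans
    (IP.recast (append_comp' col _ _) (append_comp' col _ _) _)
  exact ⟨h1, h2, h3.trans (M.map_hcomp f g).symm⟩

theorem ap_id (M : MapLaws D T.toPropData (eqRel T.toPropData) col map)
    (c : D.Col) : M.ap (D.id c) = id1 (col c) := M.map_id c

theorem ap_hprod (M : MapLaws D T.toPropData (eqRel T.toPropData) col map)
    {n p q : ℕ} {x : Fin n → Fin p → D.Col} {y : Fin n → Fin q → D.Col}
    (f : ∀ i, D.Hom (x i) (y i)) :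
    IP finProdFinEquiv finProdFinEquiv
      (prodF (x := fun i j => col (x i j)) (y := fun i j => col (y i j)) fun i => M.ap (f i))
      (M.ap (D.hprod f)) := by
  induction n with
  | zero =>
    have h := M.ap_re (finCongr (Nat.zero_mul p)) (finCongr (Nat.zero_mul q)) (grid_zero x)
      (grid_zero y) D.unit
    rw [ap_unit] at h
    exact ((IP.zero (P := T) _ _ (x := fun i j => col (x i j)) (y := fun i j => col (y i j))
      (fun i => M.ap (f i))).symm.trans h).congr (fun i => i.1.elim0) (fun i => i.1.elim0)
  | succ n ih =>
    have h := M.ap_re (finCongr (Nat.succ_mul n p)) (finCongr (Nat.succ_mul n q)) (grid_succ x)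
      (grid_succ y) (D.hcomp (D.hprod fun i => f i.castSucc) (f (Fin.last n)))
    have c := (IP.succ (x := fun i j => col (x i j)) (y := fun i j => col (y i j))
      (fun i => M.ap (f i))).symm.trans
      (((ih fun i => f i.castSucc).h (IP.refl _)).trans ((M.ap_hcomp _ _).trans h))
    refine c.congr (fun i => ?_) (fun i => ?_)
    · obtain ⟨i, rfl⟩ := (splitE (Fin.last n) (Fin p)).surjective i
      simp only [Equiv.trans_apply, Equiv.symm_apply_apply]
      rcases i with i | i
      · ext; simp
      · ext; simp [Nat.mul_comm, Nat.add_comm]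
    · obtain ⟨i, rfl⟩ := (splitE (Fin.last n) (Fin q)).surjective i
      simp only [Equiv.trans_apply, Equiv.symm_apply_apply]
      rcases i with i | i
      · ext; simp
      · ext; simp [Nat.mul_comm, Nat.add_comm]

theorem ap_idList (M : MapLaws D T.toPropData (eqRel T.toPropData) col map)
    {n : ℕ} (a : Fin n → D.Col) : M.ap (D.idList a) = idF fun i => col (a i) := by
  have h := (M.ap_hprod fun i => D.id (a i)).trans (M.ap_re (finCongr (Nat.mul_one n).symm)
    (finCongr (Nat.mul_one n).symm) (grid_one a) (grid_one a) (D.hprod fun i => D.id (a i)))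
  have h' := IP.idList fun i => col (a i)
  have e : (fun i => M.ap (D.id (a i))) = fun i => id1 (P := T) (col (a i)) :=
    funext fun i => M.ap_id _
  obtain ⟨h1, h2, h3⟩ := h
  refine IP.unique ⟨h1, h2, (congrArg _ (congrArg _ e.symm)).trans h3⟩ h' ?_ ?_ <;>
  · rintro ⟨i, j⟩
    ext
    simp

theorem ap_octUpper (M : MapLaws D T.toPropData (eqRel T.toPropData) col map)
    {n m p q : ℕ} {x : Fin n → Fin p → D.Col} {y : Fin n → Fin q → D.Col}
    {w : Fin m → Fin q → D.Col}
    (top : ∀ i, D.Hom (x i) (y i)) (right : ∀ l, D.Hom (fun i => y i l) (fun k => w k l)) :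
    map (octUpper top right) =
      octUpper (D := T.toPropData) (x := fun i j => col (x i j)) (y := fun i j => col (y i j))
        (w := fun i j => col (w i j)) (fun i => map (top i)) (fun l => map (right l)) := by
  have h1 := ((IP.sw (x := fun l i => col (y i l)) (y := fun l k => col (w k l))
    (prodF fun l => M.ap (right l))).symm.trans (M.ap_hprod right)).trans
    (M.ap_permOut (gridSwap q m) (grid_swap w) (D.hprod right))
  have h2 := (M.ap_hprod top).trans
    (M.ap_permOut (gridSwap n q) (grid_swap fun l i => y i l) (D.hprod top))
  have h1' := h1.congr (s' := (Equiv.prodComm _ _).trans finProdFinEquiv) (t' := finProdFinEquiv)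
    (fun i => rfl) (fun i => by simp [gridSwap])
  have h2' := h2.congr (t' := (Equiv.prodComm _ _).trans finProdFinEquiv) (s' := finProdFinEquiv)
    (fun i => rfl) (fun i => by simp [gridSwap])
  have h3 := IP.v h1' h2'
  rw [← ap_vcomp] at h3
  exact IP.unique h3 (octUpper_IP (P := T) (x := fun i j => col (x i j))
    (y := fun i j => col (y i j)) (w := fun i j => col (w i j)) (fun i => map (top i))
    (fun l => map (right l))) (fun _ => rfl) (fun _ => rfl)

theorem ap_octLower (M : MapLaws D T.toPropData (eqRel T.toPropData) col map)
    {n m p q : ℕ} {x : Fin n → Fin p → D.Col}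
    {z : Fin m → Fin p → D.Col} {w : Fin m → Fin q → D.Col}
    (left : ∀ j, D.Hom (fun i => x i j) (fun k => z k j))
    (bottom : ∀ k, D.Hom (z k) (w k)) :
    map (octLower left bottom) =
      octLower (D := T.toPropData) (x := fun i j => col (x i j)) (z := fun i j => col (z i j))
        (w := fun i j => col (w i j)) (fun i => map (left i)) (fun l => map (bottom l)) := by
  have h1 := (M.ap_hprod bottom).trans
    (M.ap_permIn (gridSwap p m) (grid_swap fun j k => z k j) (D.hprod bottom))
  have h2 := ((IP.sw (x := fun j i => col (x i j)) (y := fun j k => col (z k j))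
    (prodF fun l => M.ap (left l))).symm.trans (M.ap_hprod left)).trans
    (M.ap_permIn (gridSwap n p) (grid_swap x) (D.hprod left))
  have h1' := h1.congr (s' := (Equiv.prodComm _ _).trans finProdFinEquiv) (t' := finProdFinEquiv)
    (fun i => by simp [gridSwap]) (fun i => rfl)
  have h2' := h2.congr (s' := finProdFinEquiv) (t' := (Equiv.prodComm _ _).trans finProdFinEquiv)
    (fun i => by simp [gridSwap]) (fun i => rfl)
  have h3 := IP.v h1' h2'
  rw [← ap_vcomp] at h3
  exact IP.unique h3 (octLower_IP (P := T) (x := fun i j => col (x i j))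
    (z := fun i j => col (z i j)) (w := fun i j => col (w i j)) (fun i => map (left i))
    (fun l => map (bottom l))) (fun _ => rfl) (fun _ => rfl)

end MapLaws

/-- A structure that maps to props satisfies the axioms of a prop up to any relation that these
maps detect. -/
theorem PropLaws.ofFaithful {D : PropData.{u}} {r : OpRel D} {ι : Type u} {T : CProp.{u}}
    {col : ι → D.Col → T.Col}
    {map : ∀ (_ : ι) {n m : ℕ} {a : Fin n → D.Col} {b : Fin m → D.Col},
      D.Hom a b → T.Hom (fun i => col ‹_› (a i)) (fun k => col ‹_› (b k))}
    (M : ∀ i, MapLaws D T.toPropData (eqRel T.toPropData) (col i) (map i))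
    (inj : ∀ {n m : ℕ} {a : Fin n → D.Col} {b : Fin m → D.Col} (f g : D.Hom a b),
      (∀ i, (M i).ap f = (M i).ap g) → r f g) : PropLaws D r where
  vcomp_assoc f g h := inj _ _ fun i => by
    simp only [MapLaws.ap_vcomp, vF_assoc]
  hcomp_assoc f g h := inj _ _ fun i => by
    have h1 := (((M i).ap_hcomp f g).h (IP.refl _)).trans ((M i).ap_hcomp (D.hcomp f g) h)
    have h2 := ((IP.refl _).h ((M i).ap_hcomp g h)).trans ((M i).ap_hcomp f (D.hcomp g h))
    have h3 := h1.symm.trans ((IP.assoc _ _ _).trans (h2.trans ((M i).ap_re _ _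
      (append_assoc' _ _ _) (append_assoc' _ _ _) _)))
    refine h3.eq (fun j => ?_) (fun j => ?_) <;>
    · refine Fin.addCases (fun j => Fin.addCases (fun j => ?_) (fun j => ?_) j) (fun j => ?_) j <;>
      · ext
        simp [Nat.add_assoc]
  unit_hcomp f := inj _ _ fun i => by
    have h1 := (M i).ap_hcomp D.unit f
    rw [(M i).ap_unit] at h1
    refine IP.unique h1 ((IP.uhF _ _ _).trans ((M i).ap_re _ _
      (append_nil_left Fin.elim0 _) (append_nil_left Fin.elim0 _) f)) ?_ ?_ <;>
    · rintro (j | j)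
      · exact j.elim0
      · ext
        simp
  hcomp_unit f := inj _ _ fun i => by
    have h1 := (M i).ap_hcomp f D.unit
    rw [(M i).ap_unit] at h1
    refine IP.unique h1 ((IP.hFu _ _ _).trans ((M i).ap_recast
      (append_nil_right Fin.elim0 _) (append_nil_right Fin.elim0 _) f)) ?_ ?_ <;>
    · rintro (j | j)
      · rfl
      · exact j.elim0
  vcomp_id f := inj _ _ fun i => by
    rw [MapLaws.ap_vcomp, MapLaws.ap_idList, vF_id]
  id_vcomp f := inj _ _ fun i => by
    rw [MapLaws.ap_vcomp, MapLaws.ap_idList, id_vF]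
  interchange f g f' g' := inj _ _ fun i => by
    have h1 := (M i).ap_hcomp (D.vcomp f g) (D.vcomp f' g')
    rw [MapLaws.ap_vcomp, MapLaws.ap_vcomp, hF_interchange] at h1
    rw [(M i).ap_vcomp]
    exact IP.unique h1 (IP.v ((M i).ap_hcomp f f') ((M i).ap_hcomp g g'))
      (fun _ => rfl) (fun _ => rfl)
  vcomp_permOut σ h h' f g := inj _ _ fun i => by
    rw [MapLaws.ap_vcomp, MapLaws.ap_vcomp]
    have h3 := IP.v ((M i).ap_permIn σ h' f) (((M i).ap_permOut σ h g).symm.congr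
      (s' := Equiv.refl _) (t' := σ.symm) (fun _ => rfl) (fun _ => rfl))
    exact h3.eq (fun _ => rfl) (fun _ => rfl)
  permIn_vcomp σ h f g := inj _ _ fun i => by
    have h1 := (M i).ap_permIn σ h (D.vcomp f g)
    rw [MapLaws.ap_vcomp] at h1 ⊢
    exact IP.unique h1 (IP.v (IP.refl _) ((M i).ap_permIn σ h g)) (fun _ => rfl) (fun _ => rfl)
  permOut_vcomp σ h f g := inj _ _ fun i => by
    have h1 := (M i).ap_permOut σ h (D.vcomp f g)
    rw [(M i).ap_vcomp f g] at h1
    rw [(M i).ap_vcomp (D.permOut σ h f) g]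
    exact IP.unique h1 (IP.v ((M i).ap_permOut σ h f) (IP.refl _)) (fun _ => rfl) (fun _ => rfl)
  hcomp_permIn σ σ' h h' f g := inj _ _ fun i => by
    have h1 := (((M i).ap_permIn σ h f).h ((M i).ap_permIn σ' h' g)).trans ((M i).ap_hcomp _ _)
    have h2 := ((M i).ap_hcomp f g).trans ((M i).ap_permIn _ (append_sum h h') _)
    refine IP.unique h1 h2 ?_ ?_ <;> rintro (j | j) <;>
      first | rfl | simp [blockSum]
  hcomp_permOut σ σ' h h' f g := inj _ _ fun i => by
    have h1 := (((M i).ap_permOut σ h f).h ((M i).ap_permOut σ' h' g)).trans ((M i).ap_hcomp _ _)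
    have h2 := ((M i).ap_hcomp f g).trans ((M i).ap_permOut (blockSum σ σ') (append_sum h h') _)
    refine IP.unique h1 h2 ?_ ?_ <;> rintro (j | j) <;>
      first | rfl | simp [blockSum]
  hcomp_swap f g := inj _ _ fun i => by
    have h1 := ((M i).ap_hcomp f g).trans (((M i).ap_permOut finAddFlip (append_comm' _ _) _).trans
      ((M i).ap_permIn finAddFlip (append_comm' _ _) _))
    have h2 := (IP.comm _ _).trans ((M i).ap_hcomp g f)
    refine IP.unique h1 h2 ?_ ?_ <;> rintro (j | j) <;> simp [Equiv.symm_apply_eq]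
  permIn_permOut σ τ h h' f := inj _ _ fun i => by
    have h1 := ((M i).ap_permOut τ h' f).trans ((M i).ap_permIn σ h _)
    have h2 := ((M i).ap_permIn σ h f).trans ((M i).ap_permOut τ h' _)
    exact IP.unique h1 h2 (fun _ => rfl) (fun _ => rfl)
  permIn_refl f := inj _ _ fun i =>
    (((M i).ap_permIn (Equiv.refl _) (fun _ => rfl) f).eq (fun _ => rfl) (fun _ => rfl)).symm
  permOut_refl f := inj _ _ fun i =>
    (((M i).ap_permOut (Equiv.refl _) (fun _ => rfl) f).eq (fun _ => rfl) (fun _ => rfl)).symm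
  permIn_permIn σ σ' h h' f := inj _ _ fun i =>
    IP.unique (((M i).ap_permIn σ' h' f).trans ((M i).ap_permIn σ h _))
      ((M i).ap_permIn (σ.trans σ') (fun i => (h i).trans (h' (σ i))) f)
      (fun _ => rfl) (fun _ => rfl)
  permOut_permOut τ τ' h h' f := inj _ _ fun i =>
    IP.unique (((M i).ap_permOut τ' h' f).trans ((M i).ap_permOut τ h _))
      ((M i).ap_permOut (τ'.trans τ) (fun i => (h i).trans (h' (τ.symm i))) f)
      (fun _ => rfl) (fun _ => rfl)


/-! ### Homomorphisms and the mapping prop -/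

theorem CProp.IP.hrec {P : CProp.{u}} {n m p q : ℕ} {a : Fin n → P.Col} {b : Fin m → P.Col}
    {c : Fin p → P.Col} {d : Fin q → P.Col} {x : Fin (n + p) → P.Col} {y : Fin (m + q) → P.Col}
    (f : P.Hom a b) (g : P.Hom c d) (h : ∀ i, x i = Fin.append a c i)
    (h' : ∀ i, y i = Fin.append b d i) :
    IP (I := Fin n ⊕ Fin p) (I' := Fin (n + p)) (J := Fin m ⊕ Fin q) (J' := Fin (m + q))
      (a := Sum.elim a c) (b := Sum.elim b d) (a' := x) (b' := y)
      finSumFinEquiv finSumFinEquiv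
      (hF (I := Fin n) (J := Fin m) (K := Fin p) (I' := Fin q) f g)
      (P.recast h h' (P.hcomp f g)) :=
  (IP.hcomp f g).trans (IP.recast h h' _)

theorem CProp.IP.mapEq {R T : CProp.{u}} {n m : ℕ} {a : Fin n → R.Col} {b : Fin m → R.Col}
    (φ : R.Hom a b) {F F' : CPropHom R T} (h : F = F') :
    IP (P := T) (I := Fin n) (I' := Fin n) (J := Fin m) (J' := Fin m)
      (a := fun i => F.col (a i)) (b := fun k => F.col (b k))
      (a' := fun i => F'.col (a i)) (b' := fun k => F'.col (b k))
      (Equiv.refl _) (Equiv.refl _) (F.map φ) (F'.map φ) := by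
  subst h; exact IP.refl _

namespace CPropHom

variable {R S T U : CProp.{u}}

/-- The identity homomorphism. -/
def id (R : CProp.{u}) : CPropHom R R where
  col c := c
  map f := f
  laws :=
    { map_id := fun _ => rfl
      map_unit := (re_refl (P := R) R.unit).symm
      map_vcomp := fun _ _ => rfl
      map_hcomp := fun f g => (re_refl (P := R) (R.hcomp f g)).symm
      map_permIn := fun _ _ _ => rfl
      map_permOut := fun _ _ _ => rfl }

/-- Composition of homomorphisms. -/
def comp (G : CPropHom S T) (F : CPropHom R S) : CPropHom R T where
  col c := G.col (F.col c)
  map f := G.map (F.map f)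
  laws :=
    { map_id := fun c => (congrArg G.map (F.laws.map_id c)).trans (G.laws.map_id _)
      map_unit := by
        have h1 := G.laws.ap_recast (a' := fun i => F.col (Fin.elim0 i))
          (b' := fun i => F.col (Fin.elim0 i)) (fun i => i.elim0) (fun i => i.elim0) S.unit
        rw [G.laws.ap_unit] at h1
        exact (congrArg G.map F.laws.map_unit).trans (IP.unique h1 (IP.u _ _ _ _ _ _)
          (fun _ => rfl) (fun _ => rfl))
      map_vcomp := fun f g => (congrArg G.map (F.laws.map_vcomp f g)).trans (G.laws.map_vcomp _ _)
      map_hcomp := fun f g => by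
        have h1 := (G.laws.ap_hcomp (F.map f) (F.map g)).trans (G.laws.ap_recast
          (append_comp' F.col _ _) (append_comp' F.col _ _) _)
        exact (congrArg G.map (F.laws.map_hcomp f g)).trans (IP.unique h1
          ((IP.hcomp (P := T) (G.map (F.map f)) (G.map (F.map g))).trans
            (IP.recast (append_comp' (fun c => G.col (F.col c)) _ _)
              (append_comp' (fun c => G.col (F.col c)) _ _) _)) (fun _ => rfl) (fun _ => rfl))
      map_permIn := fun σ h f =>
        (congrArg G.map (F.laws.map_permIn σ h f)).trans (G.laws.map_permIn _ _ _)
      map_permOut := fun σ h f =>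
        (congrArg G.map (F.laws.map_permOut σ h f)).trans (G.laws.map_permOut _ _ _) }

end CPropHom

namespace NatTr

variable {R T : CProp.{u}} {p q r : ℕ} {f : Fin p → CPropHom R T} {g : Fin q → CPropHom R T}
  {k : Fin r → CPropHom R T}

theorem oct (ξ : NatTr f g) {n m : ℕ} {a : Fin n → R.Col} {b : Fin m → R.Col} (φ : R.Hom a b) :
    OctF (P := T) (x := fun i j => (f j).col (a i)) (y := fun i l => (g l).col (a i))
      (z := fun k j => (f j).col (b k)) (w := fun k l => (g l).col (b k))
      (fun i => ξ.app (a i)) (fun l => (g l).map φ) (fun j => (f j).map φ)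
      (fun k => ξ.app (b k)) :=
  (oct_iff _ _ _ _).1 (ξ.natural φ)

/-- The identity transformation. -/
def id (f : CPropHom R T) : NatTr (fun _ : Fin 1 => f) (fun _ : Fin 1 => f) where
  app a := T.id (f.col a)
  natural φ := (oct_iff _ _ _ _).2 (OctF.id (f.map φ))

/-- The horizontal composite of no transformations. -/
def unit : NatTr (Fin.elim0 : Fin 0 → CPropHom R T) (Fin.elim0 : Fin 0 → CPropHom R T) where
  app _ := T.recast (fun i => i.elim0) (fun i => i.elim0) T.unit
  natural _ := (oct_iff _ _ _ _).2 OctF.unit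

/-- The vertical composite. -/
def vcomp (ξ : NatTr g k) (ζ : NatTr f g) : NatTr f k where
  app a := T.vcomp (ξ.app a) (ζ.app a)
  natural φ := (oct_iff _ _ _ _).2 (OctF.v (ζ.oct φ) (ξ.oct φ))

/-- The horizontal composite. -/
def hcomp {p' q' : ℕ} {f' : Fin p' → CPropHom R T} {g' : Fin q' → CPropHom R T}
    (ξ : NatTr f g) (ζ : NatTr f' g') : NatTr (Fin.append f f') (Fin.append g g') where
  app a := T.recast (append_comp' (fun F => F.col a) f f') (append_comp' (fun F => F.col a) g g')
    (T.hcomp (ξ.app a) (ζ.app a))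
  natural {n m a b} φ := by
    refine (oct_iff _ _ _ _).2 (OctF.h _ _ _ _ (ξ.oct φ) (ζ.oct φ)
      (fun i => IP.hrec (P := T) (ξ.app (a i)) (ζ.app (a i))
        (append_comp' (fun F => F.col (a i)) f f') (append_comp' (fun F => F.col (a i)) g g'))
      (fun i => IP.hrec (P := T) (ξ.app (b i)) (ζ.app (b i))
        (append_comp' (fun F => F.col (b i)) f f') (append_comp' (fun F => F.col (b i)) g g'))
      ?_ ?_ ?_ ?_)
    · exact fun l => IP.mapEq φ (Fin.append_left g g' l).symm
    · exact fun l => IP.mapEq φ (Fin.append_right g g' l).symm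
    · exact fun l => IP.mapEq φ (Fin.append_left f f' l).symm
    · exact fun l => IP.mapEq φ (Fin.append_right f f' l).symm

/-- The right action. -/
def permIn {p' : ℕ} (σ : Fin p' ≃ Fin p) {f' : Fin p' → CPropHom R T} (h : ∀ j, f' j = f (σ j))
    (ξ : NatTr f g) : NatTr f' g where
  app a := T.permIn σ (fun j => congrArg (fun F => F.col a) (h j)) (ξ.app a)
  natural {n m a b} φ := by
    refine (oct_iff _ _ _ _).2 (OctF.perm _ _ _ _ σ.symm (Equiv.refl _) (ξ.oct φ)
      (fun i => IP.permIn σ _ _) (fun i => IP.permIn σ _ _) (fun _ => IP.refl _) ?_)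
    exact fun l => IP.mapEq φ (F := f l) (F' := f' (σ.symm l)) (by simp [h])

/-- The left action. -/
def permOut {q' : ℕ} (τ : Fin q ≃ Fin q') {g' : Fin q' → CPropHom R T}
    (h : ∀ l, g' l = g (τ.symm l)) (ξ : NatTr f g) : NatTr f g' where
  app a := T.permOut τ (fun j => congrArg (fun F => F.col a) (h j)) (ξ.app a)
  natural {n m a b} φ := by
    refine (oct_iff _ _ _ _).2 (OctF.perm _ _ _ _ (Equiv.refl _) τ (ξ.oct φ)
      (fun i => IP.permOut τ _ _) (fun i => IP.permOut τ _ _) ?_ (fun _ => IP.refl _))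
    exact fun l => IP.mapEq φ (F := g l) (F' := g' (τ l)) (by simp [h])

end NatTr

/-- The data of the mapping prop `Hom(R, T)`: its colours are the homomorphisms `R → T`, its
operations are the natural transformations, and everything is computed pointwise in `T`. -/
def inthomData (R T : CProp.{u}) : PropData.{u} where
  Col := CPropHom R T
  Hom f g := NatTr f g
  id f := NatTr.id f
  unit := NatTr.unit
  vcomp ξ ζ := ξ.vcomp ζ
  hcomp ξ ζ := ξ.hcomp ζ
  permIn σ _ h ξ := ξ.permIn σ h
  permOut τ _ h ξ := ξ.permOut τ h

/-- Evaluation at a colour. -/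
theorem inthomEval (R T : CProp.{u}) (a : R.Col) :
    MapLaws (inthomData R T) T.toPropData (eqRel T.toPropData) (fun F : CPropHom R T => F.col a)
      (fun ξ => NatTr.app ξ a) where
  map_id _ := rfl
  map_unit := rfl
  map_vcomp _ _ := rfl
  map_hcomp _ _ := rfl
  map_permIn _ _ _ := rfl
  map_permOut _ _ _ := rfl

/-- The mapping prop `Hom(R, T)`. -/
def inthom (R T : CProp.{u}) : CProp.{u} where
  toPropData := inthomData R T
  laws := PropLaws.ofFaithful (inthomEval R T) fun _ _ h => NatTr.ext (funext h)

/-- The transformation `G ∘ ξ ∘ g`. -/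
def NatTr.whisker {S S' T T' : CProp.{u}} (g : CPropHom S S') (G : CPropHom T T') {p q : ℕ}
    {f : Fin p → CPropHom S' T} {f' : Fin q → CPropHom S' T} (ξ : NatTr f f') :
    NatTr (fun j => G.comp ((f j).comp g)) (fun l => G.comp ((f' l).comp g)) where
  app c := G.map (ξ.app (g.col c))
  natural {n m a b} φ := by
    have h := congrArg G.map (ξ.natural (g.map φ))
    have h1 := G.laws.ap_octUpper (x := fun i j => (f j).col (g.col (a i)))
      (w := fun k l => (f' l).col (g.col (b k)))
      (fun i => ξ.app (g.col (a i))) (fun l => (f' l).map (g.map φ))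
    have h2 := G.laws.ap_octLower (z := fun k j => (f j).col (g.col (b k)))
      (fun j => (f j).map (g.map φ)) (fun k => ξ.app (g.col (b k)))
    exact h1.symm.trans (h.trans h2)

/-- The homomorphism `Hom(g, G) : Hom(S', T) → Hom(S, T')` of mapping props, `f ↦ G ∘ f ∘ g`. -/
def inthomMap {S S' T T' : CProp.{u}} (g : CPropHom S S') (G : CPropHom T T') :
    CPropHom (inthom S' T) (inthom S T') where
  col f := G.comp (CPropHom.comp f g)
  map ξ := NatTr.whisker g G ξ
  laws :=
    { map_id := fun f => NatTr.ext (funext fun c => G.laws.map_id _)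
      map_unit := NatTr.ext (funext fun c => by
        have h1 := G.laws.ap_recast (a' := fun i => (Fin.elim0 i : CPropHom S' T).col (g.col c))
          (b' := fun i => (Fin.elim0 i : CPropHom S' T).col (g.col c))
          (fun i => i.elim0) (fun i => i.elim0) T.unit
        rw [G.laws.ap_unit] at h1
        have h2 := (inthomEval S T' c).ap_recast (b' := fun i => G.comp (CPropHom.comp (i.elim0) g))
          (a' := fun i => G.comp (CPropHom.comp (i.elim0) g))
          (fun i => i.elim0) (fun i => i.elim0) (inthomData S T').unit
        rw [(inthomEval S T' c).ap_unit] at h2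
        exact IP.unique h1 ((IP.u _ _ _ _ (Equiv.refl _) (Equiv.refl _)).trans h2)
          (fun _ => rfl) (fun _ => rfl))
      map_vcomp := fun f g => NatTr.ext (funext fun c => G.laws.map_vcomp _ _)
      map_hcomp := fun ξ ζ => NatTr.ext (funext fun c => by
        have h1 := (G.laws.ap_hcomp (NatTr.app ξ (g.col c)) (NatTr.app ζ (g.col c))).trans
          (G.laws.ap_recast
            (append_comp' (fun F : CPropHom S' T => F.col (g.col c)) _ _)
            (append_comp' (fun F : CPropHom S' T => F.col (g.col c)) _ _) _)
        have h2 := ((inthomEval S T' c).ap_hcomp (NatTr.whisker g G ξ) (NatTr.whisker g G ζ)).trans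
          ((inthomEval S T' c).ap_recast
            (append_comp' (fun F : CPropHom S' T => G.comp (F.comp g)) _ _)
            (append_comp' (fun F : CPropHom S' T => G.comp (F.comp g)) _ _) _)
        exact IP.unique h1 h2 (fun _ => rfl) (fun _ => rfl))
      map_permIn := fun σ h f => NatTr.ext (funext fun c => G.laws.map_permIn _ _ _)
      map_permOut := fun σ h f => NatTr.ext (funext fun c => G.laws.map_permOut _ _ _) }

/-! ### Bilinear maps -/

namespace Bilin

variable {R R' S S' T T' : CProp.{u}}

/-- The bilinear map `χ(-, -)` followed by a homomorphism. -/
def postcomp (F : CPropHom T T') (β : Bilin R S T) : Bilin R S T' where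
  col a c := F.col (β.col a c)
  mapL φ c := F.map (β.mapL φ c)
  mapR a _ _ _ _ ψ := F.map (β.mapR a ψ)
  lawsR a := (F.comp ⟨fun c => β.col a c, fun ψ => β.mapR a ψ, β.lawsR a⟩).laws
  lawsL c := (F.comp ⟨fun a => β.col a c, fun φ => β.mapL φ c, β.lawsL c⟩).laws
  octagon {n m p q a b c d} φ ψ := by
    have h := congrArg F.map (β.octagon φ ψ)
    have h1 := F.laws.ap_octUpper (x := fun j i => β.col (a i) (c j))
      (w := fun l k => β.col (b k) (d l))
      (fun j => β.mapL φ (c j)) (fun k => β.mapR (b k) ψ)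
    have h2 := F.laws.ap_octLower (z := fun l i => β.col (a i) (d l))
      (fun i => β.mapR (a i) ψ) (fun l => β.mapL φ (d l))
    exact h1.symm.trans (h.trans h2)

/-- The bilinear map `χ(f(-), g(-))`. -/
def precomp (f : CPropHom R R') (g : CPropHom S S') (β : Bilin R' S' T) : Bilin R S T where
  col a c := β.col (f.col a) (g.col c)
  mapL φ c := β.mapL (f.map φ) (g.col c)
  mapR a _ _ _ _ ψ := β.mapR (f.col a) (g.map ψ)
  lawsR a := (CPropHom.comp ⟨fun c => β.col (f.col a) c, fun ψ => β.mapR (f.col a) ψ,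
    β.lawsR (f.col a)⟩ g).laws
  lawsL c := (CPropHom.comp ⟨fun a => β.col a (g.col c), fun φ => β.mapL φ (g.col c),
    β.lawsL (g.col c)⟩ f).laws
  octagon φ ψ := β.octagon (f.map φ) (g.map ψ)

/-- The homomorphism `χ(a, -)`. -/
def right (β : Bilin R S T) (a : R.Col) : CPropHom S T :=
  ⟨fun c => β.col a c, fun ψ => β.mapR a ψ, β.lawsR a⟩

/-- The homomorphism `χ(-, c)`. -/
def left (β : Bilin R S T) (c : S.Col) : CPropHom R T :=
  ⟨fun a => β.col a c, fun φ => β.mapL φ c, β.lawsL c⟩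

/-- The homomorphism `R → Hom(S, T)` that takes `a` to `χ(a, -)` and `φ` to `χ(φ, -)`. -/
def curryL (β : Bilin R S T) : CPropHom R (inthom S T) where
  col a := β.right a
  map {n m a b} φ :=
    { app := fun c => β.mapL φ c
      natural := fun ψ => β.octagon φ ψ }
  laws :=
    { map_id := fun a => NatTr.ext (funext fun c => (β.lawsL c).map_id a)
      map_unit := NatTr.ext (funext fun c => by
        have h2 := (inthomEval S T c).ap_recast (b' := fun i => β.right (Fin.elim0 i))
          (a' := fun i => β.right (Fin.elim0 i))
          (fun i => i.elim0) (fun i => i.elim0) (inthomData S T).unit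
        rw [(inthomEval S T c).ap_unit] at h2
        exact ((β.lawsL c).ap_unit).trans (IP.unique (IP.u _ _ _ _ (Equiv.refl _) (Equiv.refl _)) h2
          (fun _ => rfl) (fun _ => rfl)))
      map_vcomp := fun f g => NatTr.ext (funext fun c => (β.lawsL c).map_vcomp f g)
      map_hcomp := fun {n m p q a b a' b'} f g => NatTr.ext (funext fun c => by
        have h1 := (β.lawsL c).ap_hcomp f g
        have h2 := ((inthomEval S T c).ap_hcomp
          (a := fun i => β.right (a i)) (b := fun i => β.right (b i))
          (c := fun i => β.right (a' i)) (d := fun i => β.right (b' i))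
          ⟨fun c => β.mapL f c, fun ψ => β.octagon f ψ⟩
          ⟨fun c => β.mapL g c, fun ψ => β.octagon g ψ⟩).trans
          ((inthomEval S T c).ap_recast
            (append_comp' (fun a => β.right a) _ _)
            (append_comp' (fun a => β.right a) _ _) _)
        exact IP.unique h1 h2 (fun _ => rfl) (fun _ => rfl))
      map_permIn := fun σ h f => NatTr.ext (funext fun c => (β.lawsL c).map_permIn σ h f)
      map_permOut := fun σ h f => NatTr.ext (funext fun c => (β.lawsL c).map_permOut σ h f) }

/-- The octagon with the variables exchanged. -/
theorem octagon' (β : Bilin R S T) {n m p q : ℕ} {a : Fin n → R.Col} {b : Fin m → R.Col}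
    {c : Fin p → S.Col} {d : Fin q → S.Col} (φ : R.Hom a b) (ψ : S.Hom c d) :
    octUpper (x := fun i j => β.col (a i) (c j)) (w := fun k l => β.col (b k) (d l))
        (fun i => β.mapR (a i) ψ) (fun l => β.mapL φ (d l))
      = octLower (z := fun k j => β.col (b k) (c j))
        (fun j => β.mapL φ (c j)) (fun k => β.mapR (b k) ψ) :=
  (oct_iff _ _ _ _).2 ((oct_iff _ _ _ _).1 (β.octagon φ ψ)).transpose

/-- The bilinear map `(c, a) ↦ χ(a, c)`. -/
def flip (β : Bilin R S T) : Bilin S R T where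
  col c a := β.col a c
  mapL ψ a := β.mapR a ψ
  mapR c _ _ _ _ φ := β.mapL φ c
  lawsR c := β.lawsL c
  lawsL a := β.lawsR a
  octagon ψ φ := β.octagon' φ ψ

/-- The homomorphism `S → Hom(R, T)` that takes `c` to `χ(-, c)` and `ψ` to `χ(-, ψ)`. -/
def curryR (β : Bilin R S T) : CPropHom S (inthom R T) := β.flip.curryL

end Bilin

/-! ### The tensor product -/

/-- Formal operations on the colours `R.Col × S.Col`, generated by `φ ⊗ c` and `a ⊗ ψ` under the
structure of a prop. -/
inductive Tm (R S : CProp.{u}) :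
    {n m : ℕ} → (Fin n → R.Col × S.Col) → (Fin m → R.Col × S.Col) → Type u
  | left {n m : ℕ} {a : Fin n → R.Col} {b : Fin m → R.Col} (φ : R.Hom a b) (c : S.Col) :
      Tm R S (fun i => (a i, c)) (fun k => (b k, c))
  | right (a : R.Col) {p q : ℕ} {c : Fin p → S.Col} {d : Fin q → S.Col} (ψ : S.Hom c d) :
      Tm R S (fun j => (a, c j)) (fun l => (a, d l))
  | id (x : R.Col × S.Col) : Tm R S (fun _ : Fin 1 => x) (fun _ : Fin 1 => x)
  | unit : Tm R S (Fin.elim0 : Fin 0 → R.Col × S.Col) (Fin.elim0 : Fin 0 → R.Col × S.Col)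
  | vcomp {n m k : ℕ} {x : Fin n → R.Col × S.Col} {y : Fin m → R.Col × S.Col}
      {z : Fin k → R.Col × S.Col} (f : Tm R S y z) (g : Tm R S x y) : Tm R S x z
  | hcomp {n m p q : ℕ} {x : Fin n → R.Col × S.Col} {y : Fin m → R.Col × S.Col}
      {z : Fin p → R.Col × S.Col} {w : Fin q → R.Col × S.Col}
      (f : Tm R S x y) (g : Tm R S z w) : Tm R S (Fin.append x z) (Fin.append y w)
  | permIn {n n' m : ℕ} {x : Fin n → R.Col × S.Col} {y : Fin m → R.Col × S.Col}
      (σ : Fin n' ≃ Fin n) {x' : Fin n' → R.Col × S.Col} (h : ∀ i, x' i = x (σ i))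
      (f : Tm R S x y) : Tm R S x' y
  | permOut {n m m' : ℕ} {x : Fin n → R.Col × S.Col} {y : Fin m → R.Col × S.Col}
      (τ : Fin m ≃ Fin m') {y' : Fin m' → R.Col × S.Col} (h : ∀ k, y' k = y (τ.symm k))
      (f : Tm R S x y) : Tm R S x y'

/-- The formal operations, with the evident structure (which does not satisfy any laws yet). -/
def tmData (R S : CProp.{u}) : PropData.{u} where
  Col := R.Col × S.Col
  Hom x y := Tm R S x y
  id x := Tm.id x
  unit := Tm.unit
  vcomp f g := Tm.vcomp f g
  hcomp f g := Tm.hcomp f g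
  permIn σ _ h f := Tm.permIn σ h f
  permOut τ _ h f := Tm.permOut τ h f

/-- The congruences `r` on the formal operations modulo which these form a prop, `- ⊗ c` and
`a ⊗ -` are homomorphisms of props from `R` and `S`, and all octagons commute. -/
structure TensorCong {R S : CProp.{u}} (r : OpRel (tmData R S)) : Prop where
  refl : ∀ {n m : ℕ} {x : Fin n → R.Col × S.Col} {y : Fin m → R.Col × S.Col} (f : Tm R S x y),
    r f f
  symm : ∀ {n m : ℕ} {x : Fin n → R.Col × S.Col} {y : Fin m → R.Col × S.Col} {f g : Tm R S x y},
    r f g → r g f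
  trans : ∀ {n m : ℕ} {x : Fin n → R.Col × S.Col} {y : Fin m → R.Col × S.Col}
    {f g h : Tm R S x y}, r f g → r g h → r f h
  vcomp : ∀ {n m k : ℕ} {x : Fin n → R.Col × S.Col} {y : Fin m → R.Col × S.Col}
    {z : Fin k → R.Col × S.Col} {f f' : Tm R S y z} {g g' : Tm R S x y},
    r f f' → r g g' → r (Tm.vcomp f g) (Tm.vcomp f' g')
  hcomp : ∀ {n m p q : ℕ} {x : Fin n → R.Col × S.Col} {y : Fin m → R.Col × S.Col}
    {z : Fin p → R.Col × S.Col} {w : Fin q → R.Col × S.Col}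
    {f f' : Tm R S x y} {g g' : Tm R S z w},
    r f f' → r g g' → r (Tm.hcomp f g) (Tm.hcomp f' g')
  permIn : ∀ {n n' m : ℕ} {x : Fin n → R.Col × S.Col} {y : Fin m → R.Col × S.Col}
    (σ : Fin n' ≃ Fin n) {x' : Fin n' → R.Col × S.Col} (h : ∀ i, x' i = x (σ i))
    {f f' : Tm R S x y}, r f f' → r (Tm.permIn σ h f) (Tm.permIn σ h f')
  permOut : ∀ {n m m' : ℕ} {x : Fin n → R.Col × S.Col} {y : Fin m → R.Col × S.Col}
    (τ : Fin m ≃ Fin m') {y' : Fin m' → R.Col × S.Col} (h : ∀ k, y' k = y (τ.symm k))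
    {f f' : Tm R S x y}, r f f' → r (Tm.permOut τ h f) (Tm.permOut τ h f')
  laws : PropLaws (tmData R S) r
  left : ∀ c : S.Col, MapLaws R.toPropData (tmData R S) r (fun a => (a, c)) (fun φ => Tm.left φ c)
  right : ∀ a : R.Col, MapLaws S.toPropData (tmData R S) r (fun c => (a, c))
    (fun ψ => Tm.right a ψ)
  octagon : ∀ {n m p q : ℕ} {a : Fin n → R.Col} {b : Fin m → R.Col}
    {c : Fin p → S.Col} {d : Fin q → S.Col} (φ : R.Hom a b) (ψ : S.Hom c d),
    r (octUpper (D := tmData R S) (x := fun j i => (a i, c j)) (w := fun l k => (b k, d l))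
        (fun j => Tm.left φ (c j)) (fun k => Tm.right (b k) ψ))
      (octLower (D := tmData R S) (z := fun l i => (a i, d l))
        (fun i => Tm.right (a i) ψ) (fun l => Tm.left φ (d l)))

/-- The least such congruence. -/
def tensorRel (R S : CProp.{u}) : OpRel (tmData R S) :=
  fun _ _ _ _ f g => ∀ r : OpRel (tmData R S), TensorCong r → r f g

theorem tensorRel_cong (R S : CProp.{u}) : TensorCong (tensorRel R S) where
  refl f _ h := h.refl f
  symm hf r h := h.symm (hf r h)
  trans hf hg r h := h.trans (hf r h) (hg r h)
  vcomp hf hg r h := h.vcomp (hf r h) (hg r h)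
  hcomp hf hg r h := h.hcomp (hf r h) (hg r h)
  permIn σ _ k _ _ hf r h := h.permIn σ k (hf r h)
  permOut σ _ k _ _ hf r h := h.permOut σ k (hf r h)
  laws :=
    { vcomp_assoc := fun f g k _ h => h.laws.vcomp_assoc f g k
      hcomp_assoc := fun f g k _ h => h.laws.hcomp_assoc f g k
      unit_hcomp := fun f _ h => h.laws.unit_hcomp f
      hcomp_unit := fun f _ h => h.laws.hcomp_unit f
      vcomp_id := fun f _ h => h.laws.vcomp_id f
      id_vcomp := fun f _ h => h.laws.id_vcomp f
      interchange := fun f g f' g' _ h => h.laws.interchange f g f' g'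
      vcomp_permOut := fun σ k k' f g _ h => h.laws.vcomp_permOut σ k k' f g
      permIn_vcomp := fun σ k f g _ h => h.laws.permIn_vcomp σ k f g
      permOut_vcomp := fun σ k f g _ h => h.laws.permOut_vcomp σ k f g
      hcomp_permIn := fun σ σ' k k' f g _ h => h.laws.hcomp_permIn σ σ' k k' f g
      hcomp_permOut := fun σ σ' k k' f g _ h => h.laws.hcomp_permOut σ σ' k k' f g
      hcomp_swap := fun f g _ h => h.laws.hcomp_swap f g
      permIn_permOut := fun σ τ k k' f _ h => h.laws.permIn_permOut σ τ k k' f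
      permIn_refl := fun f _ h => h.laws.permIn_refl f
      permOut_refl := fun f _ h => h.laws.permOut_refl f
      permIn_permIn := fun σ τ k k' f _ h => h.laws.permIn_permIn σ τ k k' f
      permOut_permOut := fun σ τ k k' f _ h => h.laws.permOut_permOut σ τ k k' f }
  left c :=
    { map_id := fun a _ h => (h.left c).map_id a
      map_unit := fun _ h => (h.left c).map_unit
      map_vcomp := fun f g _ h => (h.left c).map_vcomp f g
      map_hcomp := fun f g _ h => (h.left c).map_hcomp f g
      map_permIn := fun σ k f _ h => (h.left c).map_permIn σ k f
      map_permOut := fun σ k f _ h => (h.left c).map_permOut σ k f }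
  right a :=
    { map_id := fun c _ h => (h.right a).map_id c
      map_unit := fun _ h => (h.right a).map_unit
      map_vcomp := fun f g _ h => (h.right a).map_vcomp f g
      map_hcomp := fun f g _ h => (h.right a).map_hcomp f g
      map_permIn := fun σ k f _ h => (h.right a).map_permIn σ k f
      map_permOut := fun σ k f _ h => (h.right a).map_permOut σ k f }
  octagon φ ψ _ h := h.octagon φ ψ

/-- Congruent formal operations. -/
def tensorSetoid (R S : CProp.{u}) {n m : ℕ} (x : Fin n → R.Col × S.Col)
    (y : Fin m → R.Col × S.Col) : Setoid (Tm R S x y) where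
  r f g := tensorRel R S f g
  iseqv := ⟨(tensorRel_cong R S).refl, (tensorRel_cong R S).symm, (tensorRel_cong R S).trans⟩

/-- The formal operations modulo the least congruence. -/
def tensorData (R S : CProp.{u}) : PropData.{u} where
  Col := R.Col × S.Col
  Hom x y := Quotient (tensorSetoid R S x y)
  id x := Quotient.mk _ (Tm.id x)
  unit := Quotient.mk _ Tm.unit
  vcomp := Quotient.map₂ Tm.vcomp fun _ _ hf _ _ hg => (tensorRel_cong R S).vcomp hf hg
  hcomp := Quotient.map₂ Tm.hcomp fun _ _ hf _ _ hg => (tensorRel_cong R S).hcomp hf hg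
  permIn σ _ h := Quotient.map (Tm.permIn σ h) fun _ _ hf => (tensorRel_cong R S).permIn σ h hf
  permOut τ _ h := Quotient.map (Tm.permOut τ h) fun _ _ hf => (tensorRel_cong R S).permOut τ h hf

/-- The class of a formal operation. -/
def tmk {R S : CProp.{u}} {n m : ℕ} {x : Fin n → R.Col × S.Col} {y : Fin m → R.Col × S.Col}
    (f : Tm R S x y) : (tensorData R S).Hom x y := Quotient.mk _ f

theorem tmk_eq {R S : CProp.{u}} {n m : ℕ} {x : Fin n → R.Col × S.Col} {y : Fin m → R.Col × S.Col}
    {f g : Tm R S x y} (h : tensorRel R S f g) : tmk f = tmk g := Quotient.sound h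

theorem tmk_surj {R S : CProp.{u}} {n m : ℕ} {x : Fin n → R.Col × S.Col}
    {y : Fin m → R.Col × S.Col} (F : (tensorData R S).Hom x y) : ∃ f, tmk f = F :=
  Quotient.exists_rep F

theorem tmk_hprod {R S : CProp.{u}} {n p q : ℕ} {x : Fin n → Fin p → R.Col × S.Col}
    {y : Fin n → Fin q → R.Col × S.Col} (f : ∀ i, Tm R S (x i) (y i)) :
    tmk ((tmData R S).hprod f) = (tensorData R S).hprod fun i => tmk (f i) := by
  induction n with
  | zero => rfl
  | succ n ih =>
    have e := ih fun i => f i.castSucc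
    exact congrArg (fun F => (tensorData R S).re (finCongr (Nat.succ_mul n p))
      (finCongr (Nat.succ_mul n q)) (grid_succ x) (grid_succ y)
      ((tensorData R S).hcomp F (tmk (f (Fin.last n))))) e

theorem tmk_idList {R S : CProp.{u}} {n : ℕ} (x : Fin n → R.Col × S.Col) :
    tmk ((tmData R S).idList x) = (tensorData R S).idList x :=
  congrArg ((tensorData R S).re (finCongr (Nat.mul_one n).symm) (finCongr (Nat.mul_one n).symm)
    (grid_one x) (grid_one x)) (tmk_hprod fun i => Tm.id (x i))

/-- The tensor product `R ⊗ S`: the prop with colours `R.Col × S.Col` that is presented by the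
operations `φ ⊗ c` and `a ⊗ ψ`, subject to the relations that `- ⊗ c` and `a ⊗ -` are homomorphisms
of props and that the octagons formed from operations of `R` and of `S` commute. -/
def tensor (R S : CProp.{u}) : CProp.{u} where
  toPropData := tensorData R S
  laws :=
    { vcomp_assoc := fun f g k => by
        obtain ⟨f, rfl⟩ := tmk_surj f
        obtain ⟨g, rfl⟩ := tmk_surj g
        obtain ⟨k, rfl⟩ := tmk_surj k
        exact tmk_eq ((tensorRel_cong R S).laws.vcomp_assoc f g k)
      hcomp_assoc := fun f g k => by
        obtain ⟨f, rfl⟩ := tmk_surj f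
        obtain ⟨g, rfl⟩ := tmk_surj g
        obtain ⟨k, rfl⟩ := tmk_surj k
        exact tmk_eq ((tensorRel_cong R S).laws.hcomp_assoc f g k)
      unit_hcomp := fun f => by
        obtain ⟨f, rfl⟩ := tmk_surj f
        exact tmk_eq ((tensorRel_cong R S).laws.unit_hcomp f)
      hcomp_unit := fun f => by
        obtain ⟨f, rfl⟩ := tmk_surj f
        exact tmk_eq ((tensorRel_cong R S).laws.hcomp_unit f)
      vcomp_id := fun {n m a b} f => by
        obtain ⟨f, rfl⟩ := tmk_surj f
        exact (congrArg ((tensorData R S).vcomp (tmk f)) (tmk_idList a)).symm.trans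
          (tmk_eq ((tensorRel_cong R S).laws.vcomp_id f))
      id_vcomp := fun {n m a b} f => by
        obtain ⟨f, rfl⟩ := tmk_surj f
        exact (congrArg (fun F => (tensorData R S).vcomp F (tmk f)) (tmk_idList b)).symm.trans
          (tmk_eq ((tensorRel_cong R S).laws.id_vcomp f))
      interchange := fun f g f' g' => by
        obtain ⟨f, rfl⟩ := tmk_surj f
        obtain ⟨g, rfl⟩ := tmk_surj g
        obtain ⟨f', rfl⟩ := tmk_surj f'
        obtain ⟨g', rfl⟩ := tmk_surj g'
        exact tmk_eq ((tensorRel_cong R S).laws.interchange f g f' g')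
      vcomp_permOut := fun σ k k' f g => by
        obtain ⟨f, rfl⟩ := tmk_surj f
        obtain ⟨g, rfl⟩ := tmk_surj g
        exact tmk_eq ((tensorRel_cong R S).laws.vcomp_permOut σ k k' f g)
      permIn_vcomp := fun σ k f g => by
        obtain ⟨f, rfl⟩ := tmk_surj f
        obtain ⟨g, rfl⟩ := tmk_surj g
        exact tmk_eq ((tensorRel_cong R S).laws.permIn_vcomp σ k f g)
      permOut_vcomp := fun σ k f g => by
        obtain ⟨f, rfl⟩ := tmk_surj f
        obtain ⟨g, rfl⟩ := tmk_surj g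
        exact tmk_eq ((tensorRel_cong R S).laws.permOut_vcomp σ k f g)
      hcomp_permIn := fun σ σ' k k' f g => by
        obtain ⟨f, rfl⟩ := tmk_surj f
        obtain ⟨g, rfl⟩ := tmk_surj g
        exact tmk_eq ((tensorRel_cong R S).laws.hcomp_permIn σ σ' k k' f g)
      hcomp_permOut := fun σ σ' k k' f g => by
        obtain ⟨f, rfl⟩ := tmk_surj f
        obtain ⟨g, rfl⟩ := tmk_surj g
        exact tmk_eq ((tensorRel_cong R S).laws.hcomp_permOut σ σ' k k' f g)
      hcomp_swap := fun f g => by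
        obtain ⟨f, rfl⟩ := tmk_surj f
        obtain ⟨g, rfl⟩ := tmk_surj g
        exact tmk_eq ((tensorRel_cong R S).laws.hcomp_swap f g)
      permIn_permOut := fun σ τ k k' f => by
        obtain ⟨f, rfl⟩ := tmk_surj f
        exact tmk_eq ((tensorRel_cong R S).laws.permIn_permOut σ τ k k' f)
      permIn_refl := fun f => by
        obtain ⟨f, rfl⟩ := tmk_surj f
        exact tmk_eq ((tensorRel_cong R S).laws.permIn_refl f)
      permOut_refl := fun f => by
        obtain ⟨f, rfl⟩ := tmk_surj f
        exact tmk_eq ((tensorRel_cong R S).laws.permOut_refl f)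
      permIn_permIn := fun σ τ k k' f => by
        obtain ⟨f, rfl⟩ := tmk_surj f
        exact tmk_eq ((tensorRel_cong R S).laws.permIn_permIn σ τ k k' f)
      permOut_permOut := fun σ τ k k' f => by
        obtain ⟨f, rfl⟩ := tmk_surj f
        exact tmk_eq ((tensorRel_cong R S).laws.permOut_permOut σ τ k k' f) }

/-- The canonical bilinear map `(R, S) → R ⊗ S`. -/
def tensorBilin (R S : CProp.{u}) : Bilin R S (tensor R S) where
  col a c := (a, c)
  mapL φ c := tmk (Tm.left φ c)
  mapR a _ _ _ _ ψ := tmk (Tm.right a ψ)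
  lawsR a :=
    { map_id := fun c => tmk_eq (((tensorRel_cong R S).right a).map_id c)
      map_unit := tmk_eq ((tensorRel_cong R S).right a).map_unit
      map_vcomp := fun f g => tmk_eq (((tensorRel_cong R S).right a).map_vcomp f g)
      map_hcomp := fun f g => tmk_eq (((tensorRel_cong R S).right a).map_hcomp f g)
      map_permIn := fun σ h f => tmk_eq (((tensorRel_cong R S).right a).map_permIn σ h f)
      map_permOut := fun σ h f => tmk_eq (((tensorRel_cong R S).right a).map_permOut σ h f) }
  lawsL c :=
    { map_id := fun a => tmk_eq (((tensorRel_cong R S).left c).map_id a)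
      map_unit := tmk_eq ((tensorRel_cong R S).left c).map_unit
      map_vcomp := fun f g => tmk_eq (((tensorRel_cong R S).left c).map_vcomp f g)
      map_hcomp := fun f g => tmk_eq (((tensorRel_cong R S).left c).map_hcomp f g)
      map_permIn := fun σ h f => tmk_eq (((tensorRel_cong R S).left c).map_permIn σ h f)
      map_permOut := fun σ h f => tmk_eq (((tensorRel_cong R S).left c).map_permOut σ h f) }
  octagon {n m p q a b c d} φ ψ := by
    have h := tmk_eq ((tensorRel_cong R S).octagon φ ψ)
    have e1 := tmk_hprod (x := fun j i => (a i, c j)) fun j => Tm.left φ (c j)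
    have e2 := tmk_hprod (x := fun k j => (b k, c j)) fun k => Tm.right (b k) ψ
    have e3 := tmk_hprod (x := fun i j => (a i, c j)) fun i => Tm.right (a i) ψ
    have e4 := tmk_hprod (x := fun l i => (a i, d l)) fun l => Tm.left φ (d l)
    refine Eq.trans ?_ (h.trans ?_)
    · exact congrArg₂ (fun F G => (tensorData R S).vcomp
        ((tensorData R S).permOut (gridSwap _ _) (grid_swap fun l k => (b k, d l)) F)
        ((tensorData R S).permOut (gridSwap _ _) (grid_swap fun k j => (b k, c j)) G))
        e2.symm e1.symm
    · exact congrArg₂ (fun F G => (tensorData R S).vcomp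
        ((tensorData R S).permIn (gridSwap _ _) (grid_swap fun i l => (a i, d l)) F)
        ((tensorData R S).permIn (gridSwap _ _) (grid_swap fun j i => (a i, c j)) G)) e4 e3

end PropTensor

open PropTensor

/-!
A bilinear map `β : (R, S) → T` interprets every formal operation on the colours of `R ⊗ S` as an
operation of `T`, by recursion along the structure of a prop (`Bilin.eval`). This interpretation
preserves the structure by construction (`Bilin.evalLaws`). Its kernel pair is therefore a
congruence modulo which the axioms of a prop hold, since they hold in `T`; it contains the relations
that define `R ⊗ S` because `β` is bilinear (`Bilin.evalCong`). As the tensor product is the quotient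
by the least such congruence, the interpretation descends to a homomorphism `Bilin.lift β`. Every
homomorphism out of `R ⊗ S` is determined by its values on the generators, by induction on formal
operations (`Bilin.lift_postcomp`), and this gives universality and the first bijection.

The other bijections are obtained by comparison with bilinear maps: a homomorphism `R → Hom(S, T)` is the same
as a bilinear map `(R, S) → T`, because naturality of the transformation assigned to `φ` is the
octagon for `φ` and the operations of `S` (`Bilin.curryLEquiv`); exchanging the two variables of a
bilinear map transposes the octagon (`Bilin.flipEquiv`). All naturality statements
then reduce to statements about bilinear maps, where both sides have the same components.
-/

namespace PropTensor

open CProp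

/-- Homomorphisms with the same function on colours are equal if they agree on operations; this
avoids the heterogeneous equality in the extensionality lemma of `CPropHom`. -/
theorem CPropHom.mk_eq_mk {R T : CProp.{u}} {col : R.Col → T.Col}
    {map map' : ∀ {n m : ℕ} {a : Fin n → R.Col} {b : Fin m → R.Col},
      R.Hom a b → T.Hom (fun i => col (a i)) (fun k => col (b k))}
    {laws : MapLaws R.toPropData T.toPropData (eqRel T.toPropData) col map}
    {laws' : MapLaws R.toPropData T.toPropData (eqRel T.toPropData) col map'}
    (h : ∀ {n m : ℕ} {a : Fin n → R.Col} {b : Fin m → R.Col} (f : R.Hom a b), map f = map' f) :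
    (⟨col, map, laws⟩ : CPropHom R T) = ⟨col, map', laws'⟩ := by
  have e : @map = @map' := by
    funext n m a b f
    exact h f
  subst e
  rfl

/-- If `ev` preserves the structure and `ev ∘ map` is a homomorphism, then `map` preserves the
structure modulo the kernel pair of `ev`. -/
theorem MapLaws.ofFactor {D E : PropData.{u}} {T : CProp.{u}} {col : D.Col → E.Col}
    {map : ∀ {n m : ℕ} {a : Fin n → D.Col} {b : Fin m → D.Col},
      D.Hom a b → E.Hom (fun i => col (a i)) (fun k => col (b k))}
    {col' : E.Col → T.Col}
    {ev : ∀ {n m : ℕ} {a : Fin n → E.Col} {b : Fin m → E.Col},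
      E.Hom a b → T.Hom (fun i => col' (a i)) (fun k => col' (b k))}
    (M : MapLaws E T.toPropData (eqRel T.toPropData) col' ev)
    (N : MapLaws D T.toPropData (eqRel T.toPropData) (fun c => col' (col c))
      (fun f => ev (map f))) :
    MapLaws D E (fun _ _ _ _ f g => ev f = ev g) col map where
  map_id c := (N.map_id c).trans (M.map_id _).symm
  map_unit := by
    have h := M.ap_recast (a' := fun i => col (Fin.elim0 i)) (b' := fun i => col (Fin.elim0 i))
      (fun i => i.elim0) (fun i => i.elim0) E.unit
    rw [M.ap_unit] at h
    exact N.map_unit.trans (IP.unique (IP.u _ _ _ _ _ _) h (fun _ => rfl) (fun _ => rfl))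
  map_vcomp f g := (N.map_vcomp f g).trans (M.map_vcomp _ _).symm
  map_hcomp f g := by
    have h := (M.ap_hcomp (map f) (map g)).trans
      (M.ap_recast (append_comp' col _ _) (append_comp' col _ _) _)
    exact IP.unique (N.ap_hcomp f g) h (fun _ => rfl) (fun _ => rfl)
  map_permIn σ h f := (N.map_permIn σ h f).trans (M.map_permIn σ _ _).symm
  map_permOut τ h f := (N.map_permOut τ h f).trans (M.map_permOut τ _ _).symm

namespace Bilin

variable {R R' S S' T T' : CProp.{u}}

/-- The interpretation in `T` of a formal operation, given a bilinear map `(R, S) → T`. The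
transports account for `Fin.elim0` and `Fin.append` commuting with functions on colours only up to
propositional equality. -/
def eval (β : Bilin R S T) : {n m : ℕ} → {x : Fin n → R.Col × S.Col} →
    {y : Fin m → R.Col × S.Col} → Tm R S x y →
    T.Hom (fun i => β.col (x i).1 (x i).2) (fun k => β.col (y k).1 (y k).2)
  | _, _, _, _, .left φ c => β.mapL φ c
  | _, _, _, _, .right a ψ => β.mapR a ψ
  | _, _, _, _, .id x => T.id (β.col x.1 x.2)
  | _, _, _, _, .unit => T.recast (fun i => i.elim0) (fun i => i.elim0) T.unit
  | _, _, _, _, .vcomp f g => T.vcomp (β.eval f) (β.eval g)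
  | _, _, _, _, .hcomp f g =>
    T.recast (append_comp' (fun s : R.Col × S.Col => β.col s.1 s.2) _ _)
      (append_comp' (fun s : R.Col × S.Col => β.col s.1 s.2) _ _)
      (T.hcomp (β.eval f) (β.eval g))
  | _, _, _, _, .permIn σ h f =>
    T.permIn σ (fun i => congrArg (fun s : R.Col × S.Col => β.col s.1 s.2) (h i)) (β.eval f)
  | _, _, _, _, .permOut τ h f =>
    T.permOut τ (fun k => congrArg (fun s : R.Col × S.Col => β.col s.1 s.2) (h k)) (β.eval f)

theorem evalLaws (β : Bilin R S T) :
    MapLaws (tmData R S) T.toPropData (eqRel T.toPropData)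
      (fun s : R.Col × S.Col => β.col s.1 s.2) (fun f => β.eval f) where
  map_id _ := rfl
  map_unit := rfl
  map_vcomp _ _ := rfl
  map_hcomp _ _ := rfl
  map_permIn _ _ _ := rfl
  map_permOut _ _ _ := rfl

/-- The kernel pair of the interpretation is one of the congruences that define `R ⊗ S`. -/
theorem evalCong (β : Bilin R S T) :
    TensorCong (R := R) (S := S) (fun _ _ _ _ f g => β.eval f = β.eval g) where
  refl _ := rfl
  symm h := h.symm
  trans h h' := h.trans h'
  vcomp h h' := congrArg₂ T.vcomp h h'
  hcomp h h' := congrArg₂ (fun F G => T.recast _ _ (T.hcomp F G)) h h'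
  permIn _ _ _ _ _ h := congrArg (T.permIn _ _) h
  permOut _ _ _ _ _ h := congrArg (T.permOut _ _) h
  laws := PropLaws.ofFaithful (ι := PUnit) (fun _ => β.evalLaws) fun _ _ h => h ⟨⟩
  left c := β.evalLaws.ofFactor (β.lawsL c)
  right a := β.evalLaws.ofFactor (β.lawsR a)
  octagon {n m p q a b c d} φ ψ := by
    have h1 := β.evalLaws.ap_octUpper (x := fun j i => (a i, c j)) (w := fun l k => (b k, d l))
      (fun j => Tm.left φ (c j)) (fun k => Tm.right (b k) ψ)
    have h2 := β.evalLaws.ap_octLower (z := fun l i => (a i, d l))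
      (fun i => Tm.right (a i) ψ) (fun l => Tm.left φ (d l))
    exact h1.trans ((β.octagon φ ψ).trans h2.symm)

/-- The homomorphism `R ⊗ S → T` induced by a bilinear map `(R, S) → T`. -/
def lift (β : Bilin R S T) : CPropHom (tensor R S) T where
  col s := β.col s.1 s.2
  map F := Quotient.lift (fun f => β.eval f) (fun f g (h : tensorRel R S f g) => h _ β.evalCong) F
  laws :=
    { map_id := fun _ => rfl
      map_unit := rfl
      map_vcomp := fun f g => by
        obtain ⟨f, rfl⟩ := tmk_surj f
        obtain ⟨g, rfl⟩ := tmk_surj g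
        rfl
      map_hcomp := fun f g => by
        obtain ⟨f, rfl⟩ := tmk_surj f
        obtain ⟨g, rfl⟩ := tmk_surj g
        rfl
      map_permIn := fun _ _ f => by
        obtain ⟨f, rfl⟩ := tmk_surj f
        rfl
      map_permOut := fun _ _ f => by
        obtain ⟨f, rfl⟩ := tmk_surj f
        rfl }

theorem postcomp_lift (β : Bilin R S T) : (tensorBilin R S).postcomp β.lift = β := rfl

theorem map_tmk (F : CPropHom (tensor R S) T) {n m : ℕ} {x : Fin n → R.Col × S.Col}
    {y : Fin m → R.Col × S.Col} (f : Tm R S x y) :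
    F.map (a := x) (b := y) (tmk f) = ((tensorBilin R S).postcomp F).eval f := by
  induction f with
  | left φ c => rfl
  | right a ψ => rfl
  | id x => exact F.laws.map_id x
  | unit => exact F.laws.map_unit
  | vcomp f g hf hg =>
    exact (F.laws.map_vcomp (tmk f) (tmk g)).trans (congrArg₂ T.vcomp hf hg)
  | hcomp f g hf hg =>
    exact (F.laws.map_hcomp (tmk f) (tmk g)).trans
      (congrArg₂ (fun F G => T.recast _ _ (T.hcomp F G)) hf hg)
  | permIn σ h f hf => exact (F.laws.map_permIn σ h (tmk f)).trans (congrArg (T.permIn _ _) hf)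
  | permOut τ h f hf => exact (F.laws.map_permOut τ h (tmk f)).trans (congrArg (T.permOut _ _) hf)

/-- A homomorphism out of `R ⊗ S` is determined by its values on the generators. -/
theorem lift_postcomp (F : CPropHom (tensor R S) T) :
    ((tensorBilin R S).postcomp F).lift = F := by
  refine CPropHom.mk_eq_mk (laws := ((tensorBilin R S).postcomp F).lift.laws) (laws' := F.laws)
    fun f => ?_
  obtain ⟨f, rfl⟩ := tmk_surj f
  exact (map_tmk F f).symm

/-- Bilinear maps `(R, S) → T` correspond to homomorphisms `R ⊗ S → T`. -/
def liftEquiv (R S T : CProp.{u}) : Bilin R S T ≃ CPropHom (tensor R S) T where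
  toFun β := β.lift
  invFun F := (tensorBilin R S).postcomp F
  left_inv β := β.postcomp_lift
  right_inv F := lift_postcomp F

/-- The bilinear map `χ(a, c) = F(a)(c)` given by a homomorphism `F : R → Hom(S, T)`. -/
def uncurryL (F : CPropHom R (inthom S T)) : Bilin R S T where
  col a c := (F.col a).col c
  mapL φ c := NatTr.app (F.map φ) c
  mapR a _ _ _ _ ψ := (F.col a).map ψ
  lawsR a := (F.col a).laws
  -- `χ(-, c)` is `F` followed by evaluation at `c`
  lawsL c := (CPropHom.comp (S := inthom S T)
    ⟨fun f : CPropHom S T => f.col c, fun ξ => NatTr.app ξ c, inthomEval S T c⟩ F).laws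
  octagon φ ψ := NatTr.natural (F.map φ) ψ

/-- Bilinear maps `(R, S) → T` correspond to homomorphisms `R → Hom(S, T)`. -/
def curryLEquiv (R S T : CProp.{u}) : Bilin R S T ≃ CPropHom R (inthom S T) where
  toFun β := β.curryL
  invFun F := uncurryL F
  left_inv _ := rfl
  right_inv _ := rfl

/-- Bilinear maps `(R, S) → T` correspond to bilinear maps `(S, R) → T`. -/
def flipEquiv (R S T : CProp.{u}) : Bilin R S T ≃ Bilin S R T where
  toFun β := β.flip
  invFun β := β.flip
  left_inv _ := rfl
  right_inv _ := rfl

theorem curryL_natural (f : CPropHom R R') (g : CPropHom S S') (G : CPropHom T T')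
    (β : Bilin R' S' T) :
    ((β.precomp f g).postcomp G).curryL = (inthomMap g G).comp (β.curryL.comp f) := rfl

/-- The homomorphism `f ⊗ g : R ⊗ S → R' ⊗ S'`. -/
def tensorMap (f : CPropHom R R') (g : CPropHom S S') : CPropHom (tensor R S) (tensor R' S') :=
  ((tensorBilin R' S').precomp f g).lift

theorem lift_natural (f : CPropHom R R') (g : CPropHom S S') (G : CPropHom T T')
    (β : Bilin R' S' T) :
    ((β.precomp f g).postcomp G).lift = G.comp (β.lift.comp (tensorMap f g)) :=
  (liftEquiv R S T').symm.injective rfl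

end Bilin

end PropTensor

theorem mainTheorem4 :
    -- universality of the canonical bilinear map
    (∀ (R S T : CProp.{u}) (β : Bilin R S T),
      ∃! F : CPropHom (tensor R S) T, (tensorBilin R S).postcomp F = β) ∧
    -- the resulting bijections, together with the functoriality of the tensor product
    ∃ (bil : ∀ R S T : CProp.{u}, Bilin R S T ≃ CPropHom (tensor R S) T)
      (eL : ∀ R S T : CProp.{u}, CPropHom (tensor R S) T ≃ CPropHom R (inthom S T))
      (eLR : ∀ R S T : CProp.{u}, CPropHom R (inthom S T) ≃ CPropHom S (inthom R T))
      (tmap : ∀ {R R' S S' : CProp.{u}}, CPropHom R R' → CPropHom S S' →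
        CPropHom (tensor R S) (tensor R' S')),
      -- what they are
      (∀ (R S T : CProp.{u}) (F : CPropHom (tensor R S) T),
        (bil R S T).symm F = (tensorBilin R S).postcomp F) ∧
      (∀ (R S T : CProp.{u}) (β : Bilin R S T), eL R S T (bil R S T β) = β.curryL) ∧
      (∀ (R S T : CProp.{u}) (β : Bilin R S T), eLR R S T β.curryL = β.curryR) ∧
      -- the tensor product is a functor, characterized by naturality of the canonical bilinear map
      (∀ {R R' S S' : CProp.{u}} (f : CPropHom R R') (g : CPropHom S S'),
        (tensorBilin R S).postcomp (tmap f g) = (tensorBilin R' S').precomp f g) ∧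
      (∀ R S : CProp.{u}, tmap (CPropHom.id R) (CPropHom.id S) = CPropHom.id (tensor R S)) ∧
      (∀ {R R' R'' S S' S'' : CProp.{u}} (f' : CPropHom R' R'') (f : CPropHom R R')
        (g' : CPropHom S' S'') (g : CPropHom S S'),
        tmap (f'.comp f) (g'.comp g) = (tmap f' g').comp (tmap f g)) ∧
      -- naturality of the bijections in all three variables
      (∀ {R R' S S' T T' : CProp.{u}} (f : CPropHom R R') (g : CPropHom S S')
        (G : CPropHom T T') (β : Bilin R' S' T),
        bil R S T' ((β.precomp f g).postcomp G) = G.comp ((bil R' S' T β).comp (tmap f g))) ∧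
      (∀ {R R' S S' T T' : CProp.{u}} (f : CPropHom R R') (g : CPropHom S S')
        (G : CPropHom T T') (F : CPropHom (tensor R' S') T),
        eL R S T' (G.comp (F.comp (tmap f g))) =
          (inthomMap g G).comp ((eL R' S' T F).comp f)) ∧
      (∀ {R R' S S' T T' : CProp.{u}} (f : CPropHom R R') (g : CPropHom S S')
        (G : CPropHom T T') (F : CPropHom R' (inthom S' T)),
        eLR R S T' ((inthomMap g G).comp (F.comp f)) =
          (inthomMap f G).comp ((eLR R' S' T F).comp g)) := by
  refine ⟨fun R S T β => ⟨β.lift, β.postcomp_lift, fun F hF => ?_⟩,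
    fun R S T => Bilin.liftEquiv R S T,
    fun R S T => (Bilin.liftEquiv R S T).symm.trans (Bilin.curryLEquiv R S T),
    fun R S T => (Bilin.curryLEquiv R S T).symm.trans
      ((Bilin.flipEquiv R S T).trans (Bilin.curryLEquiv S R T)),
    fun f g => Bilin.tensorMap f g,
    fun _ _ _ _ => rfl, fun _ _ _ _ => rfl, fun _ _ _ _ => rfl, fun _ _ => rfl, fun R S => ?_,
    fun f' f g' g => ?_, fun f g G β => Bilin.lift_natural f g G β, fun f g G F => ?_,
    fun f g G F => ?_⟩
  · rw [← hF, Bilin.lift_postcomp]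
  -- functoriality holds because homomorphisms out of a tensor product can be compared after
  -- composition with the canonical bilinear map
  · exact (Bilin.liftEquiv R S _).symm.injective rfl
  · exact (Bilin.liftEquiv _ _ _).symm.injective rfl
  · exact Bilin.curryL_natural f g G ((tensorBilin _ _).postcomp F)
  · exact Bilin.curryL_natural g f G (Bilin.uncurryL F).flip
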